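/- Conventions. Write $\langle\xi\rangle=(1+|\xi|^2)^{1/2}$ for $\xi\in\mathbb R^n$, and use the Fourier transform normalized by $\widehat u(\xi)=\int e^{-i\langle x,\xi\rangle}u(x)\,dx$. Let $\mathcal K_{pol}(\mathbb R^n)$ be the set of measurable functions $k:\mathbb R^n\to(0,\infty)$ for which there are constants $C,N>0$ with $k(\xi+\eta)\le C\langle\xi\rangle^N k(\eta)$ for all $\xi,\eta$. Let $\mathcal K_a(\mathbb R^n)$ be the set of $k\in\mathcal K_{pol}(\mathbb R^n)$ such that $k^{-2}*k^{-2}\le C^2k^{-2}$ for some $C>0$. Let $\mathcal K_{WL}(\mathbb R^n)$ be the set of $k\in\mathcal K_a(\mathbb R^n)$ for which there are $\delta\in(0,1)$ and $C>0$ such that $k^\delta\in\mathcal K_a(\mathbb R^n)$, $k^{-\delta}\in L^2(\mathbb R^n)$ and $k^{-2\delta}*\underline k^{-2}\le C^2\,\underline k^{-2}$, where $\underline k=\langle\cdot\rangle^{-1}k$. For $k\in\mathcal K_{pol}(\mathbb R^n)$, let $\mathcal B_k(\mathbb R^n)$ be the space of all $u\in\mathcal S'(\mathbb R^n)$ such that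 $\widehat u$ is a function and $k\widehat u\in L^2(\mathbb R^n)$, with norm $\|u\|_{\mathcal B_k}=\|k\widehat u\|_{L^2}$. Let $\mathcal B_k^\infty(\mathbb R^n)$ be the space of all distributions $u\in\mathcal D'(\mathbb R^n)$ for which there is $\chi\in\mathcal C_0^\infty(\mathbb R^n)\setminus\{0\}$ such that $u\,\chi(\cdot-y)\in\mathcal B_k(\mathbb R^n)$ for every $y\in\mathbb R^n$ and $\sup_{y}\|u\,\chi(\cdot-y)\|_{\mathcal B_k}<\infty$. A continuous function on $\mathbb R^n$ is identified with the distribution it defines. Theorem (Wiener–Lévy for $\mathcal B_k^\infty$). Let $k\in\mathcal K_{WL}(\mathbb R^n)$, let $\Omega\subset\mathbb C^d$ be open and $\Phi:\Omega\to\mathbb C$ holomorphic, and let $u=(u_1,\dots,u_d)\in\mathcal B_k^\infty(\mathbb R^n)^d$. Then each $u_j$ is a bounded continuous function, so that $u$ is a bounded continuous map $\mathbb R^n\to\mathbb C^d$; and if $\overline{u(\mathbb R^n)}\subset\Omega$, then $\Phi\circ u\in\mathcal B_k^\infty(\mathbb R^n)$. -/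

import Mathlib

open MeasureTheory TopologicalSpace
open scoped ENNReal Distributions SchwartzMap FourierTransform ContDiff

noncomputable section

namespace KatoSobolev

/-- The Euclidean space `ℝⁿ`. -/
abbrev Rn (n : ℕ) : Type := EuclideanSpace ℝ (Fin n)

/-- `𝒞₀^∞(ℝⁿ)`: complex-valued smooth functions with compact support, with its LF topology. -/
abbrev Test (n : ℕ) : Type := 𝓓((⊤ : Opens (Rn n)), ℂ)

/-- `𝒟'(ℝⁿ)`: continuous complex-linear forms on `𝒞₀^∞(ℝⁿ)`. -/
abbrev Distr (n : ℕ) : Type := Test n →L[ℂ] ℂ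

/-! ### Weight functions -/

/-- `⟨ξ⟩ = (1 + |ξ|²)^{1/2}`. -/
def bracket {n : ℕ} (ξ : Rn n) : ℝ := Real.sqrt (1 + ‖ξ‖ ^ 2)

/-- `𝒦_pol(ℝⁿ)`: weight functions of polynomial growth. -/
def Kpol (n : ℕ) : Set (Rn n → ℝ) :=
  {k | Measurable k ∧ (∀ ξ, 0 < k ξ) ∧
    ∃ C N : ℝ, 0 < C ∧ 0 < N ∧ ∀ ξ η, k (ξ + η) ≤ C * bracket ξ ^ N * k η}

/-- `k₁⁻² ∗ k₂⁻² ≤ C² k⁻²` pointwise, for some constant `C > 0`. The convolution of the nonnegative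
functions is computed in `[0, ∞]`, so that its finiteness is part of the condition. -/
def ConvLE {n : ℕ} (k₁ k₂ k : Rn n → ℝ) : Prop :=
  ∃ C : ℝ, 0 < C ∧ ∀ ξ,
    ∫⁻ η, ENNReal.ofReal (1 / k₁ η ^ 2) * ENNReal.ofReal (1 / k₂ (ξ - η) ^ 2)
      ≤ ENNReal.ofReal (C ^ 2 / k ξ ^ 2)

/-- `𝒦_a(ℝⁿ)`: the weights `k ∈ 𝒦_pol` with `k⁻² ∗ k⁻² ≤ C² k⁻²`. -/
def Ka (n : ℕ) : Set (Rn n → ℝ) := {k | k ∈ Kpol n ∧ ConvLE k k k}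

/-- `𝒦_WL(ℝⁿ)`: the weights `k ∈ 𝒦_a` for which there is `δ ∈ (0, 1)` with `k^δ ∈ 𝒦_a`,
`k^{-δ} ∈ L²` and `k^{-2δ} ∗ (⟨·⟩⁻¹k)⁻² ≤ C² (⟨·⟩⁻¹k)⁻²`. -/
def KWL (n : ℕ) : Set (Rn n → ℝ) :=
  {k | k ∈ Ka n ∧ ∃ δ : ℝ, 0 < δ ∧ δ < 1 ∧ (fun ξ => k ξ ^ δ) ∈ Ka n ∧
    MemLp (fun ξ => k ξ ^ (-δ)) 2 volume ∧
    ConvLE (fun ξ => k ξ ^ δ) (fun ξ => (bracket ξ)⁻¹ * k ξ) (fun ξ => (bracket ξ)⁻¹ * k ξ)}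

/-! ### The space `ℬ_k = B_{2,k}` -/

/-- The Fourier transform of `T ∈ 𝒮'(ℝⁿ)` is the (locally integrable) function `g`, with the
normalization `û(ξ) = ∫ e^{-i⟨x,ξ⟩} u(x) dx`. Mathlib's `𝓕` uses `e^{-2πi⟨x,ξ⟩}`, so that
`𝓕 T` is then the function `ξ ↦ g (2πξ)`. -/
def IsFourierTransform {n : ℕ} (T : 𝓢'(Rn n, ℂ)) (g : Rn n → ℂ) : Prop :=
  LocallyIntegrable g volume ∧
    ∀ φ : 𝓢(Rn n, ℂ), (𝓕 T) φ = ∫ ξ, φ ξ * g ((2 * Real.pi) • ξ)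

/-- `ℬ_k(ℝⁿ)`: the tempered distributions `T` such that the Fourier transform of `T` is a function
`g` with `k g ∈ L²`. -/
def Bk {n : ℕ} (k : Rn n → ℝ) : Set 𝓢'(Rn n, ℂ) :=
  {T | ∃ g, IsFourierTransform T g ∧ MemLp (fun ξ => (k ξ : ℂ) * g ξ) 2 volume}

/-- `‖T‖_{ℬ_k} = ‖k g‖_{L²}` where the function `g` is the Fourier transform of `T`. Such a `g` is
unique almost everywhere, so the infimum runs over equal numbers; it is `∞` if there is no `g`. -/
def normBk {n : ℕ} (k : Rn n → ℝ) (T : 𝓢'(Rn n, ℂ)) : ℝ≥0∞ :=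
  ⨅ (g : Rn n → ℂ) (_ : IsFourierTransform T g), eLpNorm (fun ξ => (k ξ : ℂ) * g ξ) 2 volume

/-! ### Localization of distributions -/

/-- The translate `τ_y χ = χ(· - y)` of a test function. -/
def translate {n : ℕ} (y : Rn n) (χ : Test n) : Test n where
  toFun x := χ (x - y)
  contDiff' := χ.contDiff.comp (contDiff_id.sub contDiff_const)
  hasCompactSupport' := χ.hasCompactSupport.comp_homeomorph (Homeomorph.subRight y)
  tsupport_subset' := fun _ _ => trivial

/-- The support of a test function as a bundled compact set. -/
def supp {n : ℕ} (χ : Test n) : Compacts (Rn n) := ⟨tsupport χ, χ.hasCompactSupport⟩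

/-- Multiplication by the test function `χ`, from the Schwartz space to smooth functions supported
in `supp χ`. -/
def mulLM {n : ℕ} (χ : Test n) : 𝓢(Rn n, ℂ) →ₗ[ℂ] 𝓓_{supp χ}(Rn n, ℂ) where
  toFun φ :=
    { toFun := fun x => χ x * φ x
      contDiff' := χ.contDiff.mul (φ.smooth ⊤)
      zero_on_compl' := fun x hx => by
        have : χ x = 0 := image_eq_zero_of_notMem_tsupport hx
        simp [this] }
  map_add' φ ψ := by
    ext x
    exact mul_add (χ x) (φ x) (ψ x)
  map_smul' c φ := by
    ext x
    exact mul_left_comm (χ x) c (φ x)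

theorem hasTemperateGrowth {n : ℕ} (χ : Test n) : (χ : Rn n → ℂ).HasTemperateGrowth :=
  (χ.hasCompactSupport.toSchwartzMap χ.contDiff).hasTemperateGrowth

theorem continuous_mulLM {n : ℕ} (χ : Test n) : Continuous (mulLM χ) := by
  refine WithSeminorms.continuous_of_continuous_comp
    (ContDiffMapSupportedIn.withSeminorms ℂ (Rn n) ℂ ⊤ (supp χ)) (mulLM χ) fun i => ?_
  let q : Seminorm ℂ 𝓢(Rn n, ℂ) :=
    (SchwartzMap.seminorm ℂ 0 i).comp (SchwartzMap.smulLeftCLM ℂ (χ : Rn n → ℂ)).toLinearMap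
  have hq : Continuous q :=
    ((schwartz_withSeminorms ℂ (Rn n) ℂ).continuous_seminorm (0, i)).comp
      (SchwartzMap.smulLeftCLM ℂ (χ : Rn n → ℂ)).continuous
  refine Seminorm.continuous_of_le hq fun φ => ?_
  refine (ContDiffMapSupportedIn.seminorm_top_le_iff ℂ (apply_nonneg q φ) i (mulLM χ φ)).2
    fun x _ => ?_
  have h : (mulLM χ φ : Rn n → ℂ) = SchwartzMap.smulLeftCLM ℂ (χ : Rn n → ℂ) φ := by
    ext x
    rw [SchwartzMap.smulLeftCLM_apply_apply (hasTemperateGrowth χ)]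
    rfl
  rw [h]
  exact SchwartzMap.norm_iteratedFDeriv_le_seminorm ℂ _ i x

/-- The product `χu ∈ 𝒮'(ℝⁿ)` of a distribution `u` with a test function `χ`:
`⟨χu, φ⟩ = ⟨u, χφ⟩` for `φ ∈ 𝒮(ℝⁿ)`. -/
def cutoff {n : ℕ} (χ : Test n) (u : Distr n) : 𝓢'(Rn n, ℂ) :=
  ContinuousLinearMap.toPointwiseConvergenceCLM _ _ _ _
    (u.comp ((TestFunction.ofSupportedInCLM ℂ (Ω := (⊤ : Opens (Rn n))) (fun _ _ => trivial)).comp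
      (⟨mulLM χ, continuous_mulLM χ⟩ : 𝓢(Rn n, ℂ) →L[ℂ] 𝓓_{supp χ}(Rn n, ℂ))))

/-! ### The space `ℬ_k^∞` -/

/-- `ℬ_k^∞(ℝⁿ)`: the distributions `u` such that, for some test function `χ ≠ 0`, all `u τ_yχ`
belong to `ℬ_k` and `sup_y ‖u τ_yχ‖_{ℬ_k} < ∞`. -/
def BkInfty {n : ℕ} (k : Rn n → ℝ) : Set (Distr n) :=
  {u | ∃ χ : Test n, χ ≠ 0 ∧ (∀ y, cutoff (translate y χ) u ∈ Bk k) ∧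
    ⨆ y, normBk k (cutoff (translate y χ) u) < ⊤}

/-- The distribution `φ ↦ ∫ φ f` defined by a locally integrable function `f`. -/
def ofFun {n : ℕ} (f : Rn n → ℂ) : Distr n :=
  TestFunction.integralAgainstBilinCLM (ContinuousLinearMap.mul ℂ ℂ) volume f

end KatoSobolev

end

open scoped NNReal Convolution

/-! In Mathlib's normalization the weight becomes `w = k(2π·)`, and `ℬ_k` becomes the space of
inverse Fourier transforms `g = 𝓕⁻ G` with `w G ∈ L²`. As `w⁻² ∗ w⁻² ≤ C² w⁻²` and `w⁻¹ ∈ L²`, this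
is a Banach algebra under pointwise multiplication, embedded in the bounded continuous functions
(`AlgWeight.hasSpec_mul`, `AlgWeight.norm_apply_le`).

Near a point `z` put `g_j = χ(· - z)(f_j - f_j(z))`. The `g_j` are bounded in the algebra uniformly
in `z`, and shrinking the support of `χ` makes their sup norms small. One would like to sum the
Taylor series of `Φ` at `f(z)` in the `g_j`, but a small sup norm does not make the algebra norm
small. What is needed is that powers of `g` grow like powers of its sup norm, uniformly over all
such `g`; a spectral radius formula for individual elements would not give the uniformity.

This is `WLWeight.exists_isMul_pow`. The weights `v = w^δ + l w` define equivalent norms whose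
product constant does not depend on `l` (`WLWeight.algWeight`); for `l w` alone it would be of order
`1/l`. Since `w → ∞` at infinity, `w^δ ≤ l w` for `|ξ| ≥ R`, so the high-frequency part `h` of `g`
has `v`-norm `O(l)`, small for small `l`. The low-frequency part `a` is band-limited: the spectrum
of `a^j` lies in a ball of radius `jR`, where `v` is polynomially bounded, and Plancherel's theorem
bounds the `L²` norm of `a^j` by a power of the sup norm (`AlgWeight.inA_pow_bandlimited`). The
binomial formula for `(a + h)^m` then costs only a polynomial factor in `m`.

With Cauchy's estimates on a polydisc (`exists_hasSum_taylor`), the Taylor series multiplied by a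
cutoff `ψ` converges absolutely in the `v`-norm, with bounds independent of `z`
(`WLWeight.wienerLevy`). The link with distributions is `BkInfty.exists_eq_ofFun` in one direction
and `mem_Bk_of_inA` in the other. -/

namespace KatoSobolev

/-! ### Weighted `L²` Fourier algebras: embedding and products -/

section Algebra

variable {V : Type*} [NormedAddCommGroup V] [InnerProductSpace ℝ V] [FiniteDimensional ℝ V]
  [MeasurableSpace V] [BorelSpace V]

/-- `g` is the inverse Fourier transform of `G`, and `‖v G‖_{L²} ≤ M`. -/
structure HasSpec (v : V → ℝ) (g G : V → ℂ) (M : ℝ≥0) : Prop where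
  meas : AEStronglyMeasurable G volume
  norm_le : eLpNorm (fun ξ => (v ξ : ℂ) * G ξ) 2 volume ≤ M
  eq : g = 𝓕⁻ G

/-- `g` is the inverse Fourier transform of some `G` with `‖v G‖_{L²} ≤ M`. -/
def InA (v : V → ℝ) (g : V → ℂ) (M : ℝ≥0) : Prop := ∃ G, HasSpec v g G M

/-- A positive weight `v` with `‖v⁻¹‖_{L²} ≤ C` and `v⁻² ∗ v⁻² ≤ C² v⁻²`. -/
structure AlgWeight (v : V → ℝ) (C : ℝ≥0) : Prop where
  meas : Measurable v
  pos : ∀ ξ, 0 < v ξ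
  inv_norm_le : eLpNorm (fun ξ => ((v ξ : ℂ))⁻¹) 2 volume ≤ C
  conv_le : ∀ ξ, ∫⁻ η, ENNReal.ofReal (1 / v η ^ 2) * ENNReal.ofReal (1 / v (ξ - η) ^ 2)
    ≤ ENNReal.ofReal (C ^ 2 / v ξ ^ 2)

theorem eLpNorm_two_sq (f : V → ℂ) :
    eLpNorm f 2 volume ^ 2 = ∫⁻ ξ, ‖f ξ‖ₑ ^ 2 := by
  have := eLpNorm_nnreal_pow_eq_lintegral (f := f) (μ := (volume : Measure V)) (p := 2) two_ne_zero
  simpa using this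

theorem eLpNorm_two_le_iff (f : V → ℂ) (M : ℝ≥0) :
    eLpNorm f 2 volume ≤ M ↔ ∫⁻ ξ, ‖f ξ‖ₑ ^ 2 ≤ (M : ℝ≥0∞) ^ 2 := by
  rw [← eLpNorm_two_sq]
  exact (ENNReal.pow_le_pow_left_iff two_ne_zero).symm

theorem lintegral_mul_sq_le {f g : V → ℝ≥0∞} (hf : AEMeasurable f volume)
    (hg : AEMeasurable g volume) :
    (∫⁻ ξ, f ξ * g ξ) ^ 2 ≤ (∫⁻ ξ, f ξ ^ 2) * ∫⁻ ξ, g ξ ^ 2 := by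
  have h := ENNReal.lintegral_mul_le_Lp_mul_Lq volume Real.HolderConjugate.two_two hf hg
  calc _ ≤ ((∫⁻ ξ, f ξ ^ (2 : ℝ)) ^ (1 / 2 : ℝ) * (∫⁻ ξ, g ξ ^ (2 : ℝ)) ^ (1 / 2 : ℝ)) ^ 2 := by
        gcongr; exact h
    _ = _ := by
        rw [mul_pow, ← ENNReal.rpow_natCast, ← ENNReal.rpow_natCast, ← ENNReal.rpow_mul,
          ← ENNReal.rpow_mul]
        simp

namespace AlgWeight

variable {v : V → ℝ} {C : ℝ≥0} {g g₁ g₂ G G₁ G₂ : V → ℂ} {M M₁ M₂ : ℝ≥0}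

/-- Cauchy–Schwarz applied to `G = v⁻¹ · (v G)`. It makes the inversion integral absolutely
convergent, hence the sup bound and the continuity of `g`. -/
theorem eLpNorm_one_le (hv : AlgWeight v C) (hg : HasSpec v g G M) :
    eLpNorm G 1 volume ≤ (C * M : ℝ≥0) := by
  have hm : AEStronglyMeasurable (fun ξ => (v ξ : ℂ)) volume :=
    (Complex.measurable_ofReal.comp hv.meas).aestronglyMeasurable
  have h := eLpNorm_smul_le_mul_eLpNorm (p := 2) (q := 2) (r := 1) (μ := (volume : Measure V))
    (hm.mul hg.meas) (hm.inv₀)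
  have e : (fun ξ => ((v ξ : ℂ))⁻¹) • (fun ξ => (v ξ : ℂ) * G ξ) = G := by
    ext ξ
    have : (v ξ : ℂ) ≠ 0 := by exact_mod_cast (hv.pos ξ).ne'
    simp [this]
  calc _ = eLpNorm ((fun ξ => ((v ξ : ℂ))⁻¹) • (fun ξ => (v ξ : ℂ) * G ξ)) 1 volume := by rw [e]
    _ ≤ _ := h
    _ ≤ C * M := mul_le_mul' hv.inv_norm_le hg.norm_le
    _ = _ := by simp

theorem integrable (hv : AlgWeight v C) (hg : HasSpec v g G M) : Integrable G volume :=
  memLp_one_iff_integrable.1 ⟨hg.meas, (hv.eLpNorm_one_le hg).trans_lt ENNReal.coe_lt_top⟩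

theorem integral_norm_le (hv : AlgWeight v C) (hg : HasSpec v g G M) :
    ∫ ξ, ‖G ξ‖ ≤ C * M := by
  rw [integral_norm_eq_lintegral_enorm hg.meas, ← eLpNorm_one_eq_lintegral_enorm]
  simpa using ENNReal.toReal_mono ENNReal.coe_ne_top (hv.eLpNorm_one_le hg)

theorem norm_apply_le (hv : AlgWeight v C) (hg : HasSpec v g G M) (x : V) : ‖g x‖ ≤ C * M := by
  rw [hg.eq, Real.fourierInv_eq]
  refine (norm_integral_le_integral_norm _).trans ?_
  simpa using hv.integral_norm_le hg

theorem continuous (hv : AlgWeight v C) (hg : HasSpec v g G M) : Continuous g := by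
  have h : Continuous (𝓕 G) := VectorFourier.fourierIntegral_continuous Real.continuous_fourierChar
    (by exact continuous_inner) (hv.integrable hg)
  have e : g = fun x => 𝓕 G (-x) := by
    ext x
    rw [hg.eq, Real.fourierInv_eq_fourier_neg]
  rw [e]
  exact h.comp continuous_neg

/-- Cauchy–Schwarz after inserting `v⁻¹ v` in both factors: the square integral of `v(η)⁻¹ v(ξ -
η)⁻¹` is at most `C² / v(ξ)²`, which cancels the outer weight. What remains is an unweighted
convolution of `(v a)²` and `(v b)²`, integrated by Tonelli. -/
theorem lintegral_conv_le (hv : AlgWeight v C) {a b : V → ℝ≥0∞} (ha : AEMeasurable a volume)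
    (hb : AEMeasurable b volume) :
    ∫⁻ ξ, (ENNReal.ofReal (v ξ) * ∫⁻ η, a η * b (ξ - η)) ^ 2
      ≤ (C : ℝ≥0∞) ^ 2 * ((∫⁻ ξ, (ENNReal.ofReal (v ξ) * a ξ) ^ 2) *
        ∫⁻ ξ, (ENNReal.ofReal (v ξ) * b ξ) ^ 2) := by
  have hvm : Measurable fun ξ => ENNReal.ofReal (v ξ) := hv.meas.ennreal_ofReal
  have hva : AEMeasurable (fun ξ => (ENNReal.ofReal (v ξ) * a ξ) ^ 2) volume :=
    (hvm.aemeasurable.mul ha).pow_const 2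
  have hvb : AEMeasurable (fun ξ => (ENNReal.ofReal (v ξ) * b ξ) ^ 2) volume :=
    (hvm.aemeasurable.mul hb).pow_const 2
  have qmp : ∀ ξ : V, Measure.QuasiMeasurePreserving (fun η => ξ - η) volume volume :=
    fun ξ => (Measure.measurePreserving_sub_left volume ξ).quasiMeasurePreserving
  have hcan : ∀ ξ, ENNReal.ofReal (v ξ)⁻¹ * ENNReal.ofReal (v ξ) = 1 := fun ξ => by
    rw [← ENNReal.ofReal_mul (inv_nonneg.2 (hv.pos ξ).le), inv_mul_cancel₀ (hv.pos ξ).ne']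
    simp
  have point : ∀ ξ, (ENNReal.ofReal (v ξ) * ∫⁻ η, a η * b (ξ - η)) ^ 2 ≤
      (C : ℝ≥0∞) ^ 2 * ∫⁻ η, (ENNReal.ofReal (v η) * a η) ^ 2 *
        (ENNReal.ofReal (v (ξ - η)) * b (ξ - η)) ^ 2 := by
    intro ξ
    have e : ∀ η, a η * b (ξ - η) =
        (ENNReal.ofReal (v η)⁻¹ * ENNReal.ofReal (v (ξ - η))⁻¹) *
        ((ENNReal.ofReal (v η) * a η) * (ENNReal.ofReal (v (ξ - η)) * b (ξ - η))) := by
      intro η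
      calc _ = (ENNReal.ofReal (v η)⁻¹ * ENNReal.ofReal (v η)) *
            (ENNReal.ofReal (v (ξ - η))⁻¹ * ENNReal.ofReal (v (ξ - η))) * (a η * b (ξ - η)) := by
              rw [hcan, hcan]; simp
        _ = _ := by ring
    have m1 : AEMeasurable
        (fun η => ENNReal.ofReal (v η)⁻¹ * ENNReal.ofReal (v (ξ - η))⁻¹) volume := by
      have h1 : Measurable fun η => ENNReal.ofReal (v η)⁻¹ := hv.meas.inv.ennreal_ofReal
      exact (h1.mul (h1.comp (measurable_const.sub measurable_id))).aemeasurable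
    have m2 : AEMeasurable (fun η => (ENNReal.ofReal (v η) * a η) *
        (ENNReal.ofReal (v (ξ - η)) * b (ξ - η))) volume :=
      (hvm.aemeasurable.mul ha).mul
        ((hvm.aemeasurable.mul hb).comp_quasiMeasurePreserving (qmp ξ))
    have h := lintegral_mul_sq_le m1 m2
    simp_rw [← e] at h
    have e2 : ∀ η, (ENNReal.ofReal (v η)⁻¹ * ENNReal.ofReal (v (ξ - η))⁻¹) ^ 2 =
        ENNReal.ofReal (1 / v η ^ 2) * ENNReal.ofReal (1 / v (ξ - η) ^ 2) := by
      intro η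
      rw [mul_pow, ← ENNReal.ofReal_pow (inv_nonneg.2 (hv.pos _).le),
        ← ENNReal.ofReal_pow (inv_nonneg.2 (hv.pos _).le)]
      simp
    simp_rw [e2] at h
    rw [mul_pow]
    calc _ ≤ ENNReal.ofReal (v ξ) ^ 2 * (ENNReal.ofReal (C ^ 2 / v ξ ^ 2) *
          ∫⁻ η, ((ENNReal.ofReal (v η) * a η) * (ENNReal.ofReal (v (ξ - η)) * b (ξ - η))) ^ 2) := by
            gcongr
            refine h.trans ?_
            gcongr
            exact hv.conv_le ξ
      _ = _ := by
        rw [← mul_assoc, ← ENNReal.ofReal_pow (hv.pos ξ).le, ← ENNReal.ofReal_mul (by positivity)]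
        have : v ξ ^ 2 * ((C : ℝ) ^ 2 / v ξ ^ 2) = (C : ℝ) ^ 2 := by
          have := (hv.pos ξ).ne'
          field_simp
        rw [this, ENNReal.ofReal_pow C.coe_nonneg, ENNReal.ofReal_coe_nnreal]
        simp_rw [mul_pow]
  calc _ ≤ ∫⁻ ξ, (C : ℝ≥0∞) ^ 2 * ∫⁻ η, (ENNReal.ofReal (v η) * a η) ^ 2 *
        (ENNReal.ofReal (v (ξ - η)) * b (ξ - η)) ^ 2 := lintegral_mono point
    _ = (C : ℝ≥0∞) ^ 2 * ∫⁻ ξ, ∫⁻ η, (ENNReal.ofReal (v η) * a η) ^ 2 *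
        (ENNReal.ofReal (v (ξ - η)) * b (ξ - η)) ^ 2 := by
        rw [lintegral_const_mul' _ _ (by simp)]
    _ = (C : ℝ≥0∞) ^ 2 * ∫⁻ η, ∫⁻ ξ, (ENNReal.ofReal (v η) * a η) ^ 2 *
        (ENNReal.ofReal (v (ξ - η)) * b (ξ - η)) ^ 2 := by
        rw [lintegral_lintegral_swap]
        refine AEMeasurable.mul (hva.comp_snd) ?_
        exact hvb.comp_quasiMeasurePreserving
          (quasiMeasurePreserving_sub_of_right_invariant volume volume)
    _ = _ := by
        congr 1
        rw [← lintegral_mul_const'' _ hva]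
        refine lintegral_congr fun η => ?_
        have m : AEMeasurable (fun ξ => (ENNReal.ofReal (v (ξ - η)) * b (ξ - η)) ^ 2) volume :=
          hvb.comp_quasiMeasurePreserving
            (measurePreserving_sub_right volume η).quasiMeasurePreserving
        rw [lintegral_const_mul'' _ m,
          lintegral_sub_right_eq_self (fun ξ => (ENNReal.ofReal (v ξ) * b ξ) ^ 2) η]

theorem enorm_ofReal_mul (hv : AlgWeight v C) (G : V → ℂ) (ξ : V) :
    ‖(v ξ : ℂ) * G ξ‖ₑ = ENNReal.ofReal (v ξ) * ‖G ξ‖ₑ := by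
  rw [enorm_mul]
  congr 1
  rw [← ofReal_norm, Complex.norm_real, Real.norm_of_nonneg (hv.pos ξ).le]

theorem hasSpec_mul (hv : AlgWeight v C) (h₁ : HasSpec v g₁ G₁ M₁) (h₂ : HasSpec v g₂ G₂ M₂) :
    HasSpec v (g₁ * g₂) (G₁ ⋆[ContinuousLinearMap.mul ℂ ℂ] G₂) (C * M₁ * M₂) where
  meas := ((hv.integrable h₁).integrable_convolution _ (hv.integrable h₂)).aestronglyMeasurable
  norm_le := by
    rw [eLpNorm_two_le_iff]
    have b₁ := (eLpNorm_two_le_iff _ _).1 h₁.norm_le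
    have b₂ := (eLpNorm_two_le_iff _ _).1 h₂.norm_le
    simp_rw [hv.enorm_ofReal_mul] at b₁ b₂ ⊢
    calc _ ≤ ∫⁻ ξ, (ENNReal.ofReal (v ξ) * ∫⁻ η, ‖G₁ η‖ₑ * ‖G₂ (ξ - η)‖ₑ) ^ 2 := by
          refine lintegral_mono fun ξ => ?_
          dsimp only
          gcongr
          refine (enorm_integral_le_lintegral_enorm _).trans (le_of_eq ?_)
          simp [enorm_mul]
      _ ≤ _ := hv.lintegral_conv_le h₁.meas.enorm h₂.meas.enorm
      _ ≤ (C : ℝ≥0∞) ^ 2 * ((M₁ : ℝ≥0∞) ^ 2 * (M₂ : ℝ≥0∞) ^ 2) := by gcongr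
      _ = _ := by push_cast; ring
  eq := by
    ext x
    rw [Real.fourierInv_eq_fourier_neg, Real.fourier_mul_convolution_eq (hv.integrable h₁)
      (hv.integrable h₂), Pi.mul_apply, h₁.eq, h₂.eq, Real.fourierInv_eq_fourier_neg,
      Real.fourierInv_eq_fourier_neg]

theorem hasSpec_add (hv : AlgWeight v C) (h₁ : HasSpec v g₁ G₁ M₁) (h₂ : HasSpec v g₂ G₂ M₂) :
    HasSpec v (g₁ + g₂) (G₁ + G₂) (M₁ + M₂) where
  meas := h₁.meas.add h₂.meas
  norm_le := by
    have hm : AEStronglyMeasurable (fun ξ => (v ξ : ℂ)) volume :=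
      (Complex.measurable_ofReal.comp hv.meas).aestronglyMeasurable
    have e : (fun ξ => (v ξ : ℂ) * (G₁ + G₂) ξ) =
        (fun ξ => (v ξ : ℂ) * G₁ ξ) + fun ξ => (v ξ : ℂ) * G₂ ξ := by
      ext ξ
      simp [mul_add]
    rw [e]
    refine (eLpNorm_add_le (hm.mul h₁.meas) (hm.mul h₂.meas) (by norm_num)).trans ?_
    push_cast
    exact add_le_add h₁.norm_le h₂.norm_le
  eq := by
    ext x
    rw [Pi.add_apply, h₁.eq, h₂.eq, Real.fourierInv_eq, Real.fourierInv_eq, Real.fourierInv_eq,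
      ← integral_add]
    · simp [smul_add]
    · have := (Real.fourierIntegral_convergent_iff (-x)).2 (hv.integrable h₁)
      simpa using this
    · have := (Real.fourierIntegral_convergent_iff (-x)).2 (hv.integrable h₂)
      simpa using this

end AlgWeight

end Algebra

/-! ### Linear operations, completeness and multipliers -/

section Algebra

variable {V : Type*} [NormedAddCommGroup V] [InnerProductSpace ℝ V] [FiniteDimensional ℝ V]
  [MeasurableSpace V] [BorelSpace V]

namespace HasSpec

variable {v v' : V → ℝ} {g G : V → ℂ} {M M' : ℝ≥0}

theorem mono (h : HasSpec v g G M) (hM : M ≤ M') : HasSpec v g G M' :=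
  ⟨h.meas, h.norm_le.trans (by exact_mod_cast hM), h.eq⟩

theorem of_weight_le (h : HasSpec v g G M) {c : ℝ≥0} (h0 : ∀ ξ, 0 ≤ v' ξ)
    (hle : ∀ ξ, v' ξ ≤ c * v ξ) : HasSpec v' g G (c * M) where
  meas := h.meas
  norm_le := by
    have : eLpNorm (fun ξ => (v' ξ : ℂ) * G ξ) 2 volume ≤
        c • eLpNorm (fun ξ => (v ξ : ℂ) * G ξ) 2 volume := by
      refine eLpNorm_le_nnreal_smul_eLpNorm_of_ae_le_mul (ae_of_all _ fun ξ => ?_) _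
      rw [← NNReal.coe_le_coe]
      push_cast
      rw [norm_mul, norm_mul, Complex.norm_real, Complex.norm_real, Real.norm_of_nonneg (h0 ξ),
        ← mul_assoc]
      gcongr
      exact (hle ξ).trans (by gcongr; exact le_abs_self _)
    refine this.trans ?_
    rw [ENNReal.smul_def, smul_eq_mul, ENNReal.coe_mul]
    exact mul_le_mul_right h.norm_le _
  eq := h.eq

theorem const_smul (h : HasSpec v g G M) (c : ℂ) : HasSpec v (c • g) (c • G) (‖c‖₊ * M) where
  meas := h.meas.const_smul c
  norm_le := by
    have e : (fun ξ => (v ξ : ℂ) * (c • G) ξ) = c • fun ξ => (v ξ : ℂ) * G ξ := by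
      ext ξ
      simp only [Pi.smul_apply, smul_eq_mul]
      ring
    rw [e, eLpNorm_const_smul, ENNReal.coe_mul]
    exact mul_le_mul_right h.norm_le _
  eq := by
    ext x
    rw [Pi.smul_apply, h.eq, Real.fourierInv_eq, Real.fourierInv_eq, ← integral_smul]
    refine integral_congr_ae (ae_of_all _ fun ξ => ?_)
    simp only [Pi.smul_apply, smul_eq_mul, Circle.smul_def]
    ring

theorem comp_sub (h : HasSpec v g G M) (y : V) :
    HasSpec v (fun x => g (x - y)) (fun ξ => Real.fourierChar (-inner ℝ ξ y) • G ξ) M where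
  meas := by
    have : Continuous fun ξ : V => Real.fourierChar (-inner ℝ ξ y) :=
      Real.continuous_fourierChar.comp (by fun_prop)
    exact this.aestronglyMeasurable.smul h.meas
  norm_le := by
    refine le_trans (le_of_eq (eLpNorm_congr_norm_ae (ae_of_all _ fun ξ => ?_))) h.norm_le
    rw [norm_mul, norm_mul, Circle.norm_smul]
  eq := by
    ext x
    rw [h.eq, Real.fourierInv_eq, Real.fourierInv_eq]
    refine integral_congr_ae (ae_of_all _ fun ξ => ?_)
    dsimp only
    rw [smul_smul, ← AddChar.map_add_eq_mul, inner_sub_right, sub_eq_add_neg]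

theorem zero (v : V → ℝ) : HasSpec v (0 : V → ℂ) 0 0 where
  meas := aestronglyMeasurable_const
  norm_le := by simp
  eq := by
    ext x
    rw [Real.fourierInv_eq]
    simp

end HasSpec

namespace InA

variable {v v' : V → ℝ} {C : ℝ≥0} {g g₁ g₂ : V → ℂ} {M M' M₁ M₂ : ℝ≥0}

theorem mono (h : InA v g M) (hM : M ≤ M') : InA v g M' := h.imp fun _ hG => hG.mono hM

theorem of_weight_le (h : InA v g M) {c : ℝ≥0} (h0 : ∀ ξ, 0 ≤ v' ξ)
    (hle : ∀ ξ, v' ξ ≤ c * v ξ) : InA v' g (c * M) := h.imp fun _ hG => hG.of_weight_le h0 hle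

theorem const_smul (h : InA v g M) (c : ℂ) : InA v (c • g) (‖c‖₊ * M) :=
  h.elim fun _ hG => ⟨_, hG.const_smul c⟩

theorem comp_sub (h : InA v g M) (y : V) : InA v (fun x => g (x - y)) M :=
  h.elim fun _ hG => ⟨_, hG.comp_sub y⟩

theorem add (hv : AlgWeight v C) (h₁ : InA v g₁ M₁) (h₂ : InA v g₂ M₂) :
    InA v (g₁ + g₂) (M₁ + M₂) := by
  obtain ⟨G₁, hG₁⟩ := h₁
  obtain ⟨G₂, hG₂⟩ := h₂
  exact ⟨_, hv.hasSpec_add hG₁ hG₂⟩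

theorem mul (hv : AlgWeight v C) (h₁ : InA v g₁ M₁) (h₂ : InA v g₂ M₂) :
    InA v (g₁ * g₂) (C * M₁ * M₂) := by
  obtain ⟨G₁, hG₁⟩ := h₁
  obtain ⟨G₂, hG₂⟩ := h₂
  exact ⟨_, hv.hasSpec_mul hG₁ hG₂⟩

theorem norm_apply_le (hv : AlgWeight v C) (h : InA v g M) (x : V) : ‖g x‖ ≤ C * M :=
  h.elim fun _ hG => hv.norm_apply_le hG x

theorem continuous (hv : AlgWeight v C) (h : InA v g M) : Continuous g :=
  h.elim fun _ hG => hv.continuous hG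

/-- Completeness: an absolutely convergent series of functions in the algebra. -/
theorem hasSum {ι : Type*} (hv : AlgWeight v C) {F : ι → V → ℂ} {K : ι → ℝ≥0} {f : V → ℂ}
    (hF : ∀ i, InA v (F i) (K i)) (hK : Summable K) (hf : ∀ x, HasSum (fun i => F i x) (f x)) :
    InA v f (∑' i, K i) := by
  choose G hG using hF
  have hm : AEStronglyMeasurable (fun ξ => (v ξ : ℂ)) volume :=
    (Complex.measurable_ofReal.comp hv.meas).aestronglyMeasurable
  have hvne : ∀ ξ, (v ξ : ℂ) ≠ 0 := fun ξ => by exact_mod_cast (hv.pos ξ).ne'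
  have hL : ∀ i, MemLp (fun ξ => (v ξ : ℂ) * G i ξ) 2 volume := fun i =>
    ⟨hm.mul (hG i).meas, (hG i).norm_le.trans_lt ENNReal.coe_lt_top⟩
  let L : ι → Lp ℂ 2 (volume : Measure V) := fun i => (hL i).toLp
  have hLn : ∀ i, ‖L i‖ ≤ K i := fun i => by
    rw [Lp.norm_toLp]
    simpa using ENNReal.toReal_mono ENNReal.coe_ne_top (hG i).norm_le
  have hKs : Summable fun i => (K i : ℝ) := NNReal.summable_coe.2 hK
  have hLs : Summable L := Summable.of_norm_bounded hKs hLn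
  have hnorm : ‖∑' i, L i‖ ≤ ∑' i, (K i : ℝ) := by
    refine (norm_tsum_le_tsum_norm (Summable.of_nonneg_of_le (fun _ => norm_nonneg _) hLn hKs)).trans
      ?_
    exact Summable.tsum_le_tsum hLn (Summable.of_nonneg_of_le (fun _ => norm_nonneg _) hLn hKs) hKs
  set S : Lp ℂ 2 (volume : Measure V) := ∑' i, L i with hS
  have he : ∀ x : V, MemLp
      (fun ξ => (starRingEnd ℂ) ((Real.fourierChar (inner ℝ ξ x) : ℂ) * (v ξ : ℂ)⁻¹)) 2 volume := by
    intro x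
    have hc : Continuous fun ξ : V => ((Real.fourierChar (inner ℝ ξ x) : Circle) : ℂ) :=
      continuous_subtype_val.comp (Real.continuous_fourierChar.comp (by fun_prop))
    refine ⟨Complex.continuous_conj.comp_aestronglyMeasurable
      (hc.aestronglyMeasurable.mul hm.inv₀), ?_⟩
    refine lt_of_le_of_lt (le_of_eq (eLpNorm_congr_norm_ae (ae_of_all _ fun ξ => ?_)))
      (hv.inv_norm_le.trans_lt ENNReal.coe_lt_top)
    rw [RCLike.norm_conj, norm_mul, Circle.norm_coe, one_mul]
  -- Evaluation at `x` is the inner product of `v G` with the fixed `L²` function conjugate to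
  -- `e^{2πi⟨ξ,x⟩} v(ξ)⁻¹`. It is therefore continuous on `L²`, which identifies the sum of the
  -- series in `L²` with the pointwise sum.
  have inner_eq : ∀ (x : V) (U : Lp ℂ 2 (volume : Measure V)) (H : V → ℂ),
      (U : V → ℂ) =ᵐ[volume] (fun ξ => (v ξ : ℂ) * H ξ) →
      inner ℂ ((he x).toLp) U = 𝓕⁻ H x := by
    intro x U H hU
    rw [L2.inner_def, Real.fourierInv_eq]
    refine integral_congr_ae ?_
    filter_upwards [hU, (he x).coeFn_toLp] with ξ h1 h2
    rw [h1, h2]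
    have := hvne ξ
    simp only [RCLike.inner_apply, Complex.conj_conj, Circle.smul_def, smul_eq_mul]
    field_simp
  refine ⟨fun ξ => (v ξ : ℂ)⁻¹ * S ξ, ⟨hm.inv₀.mul (Lp.aestronglyMeasurable S), ?_, ?_⟩⟩
  · have e : (fun ξ => (v ξ : ℂ) * ((v ξ : ℂ)⁻¹ * S ξ)) = S := by
      ext ξ
      rw [mul_inv_cancel_left₀ (hvne ξ)]
    rw [e]
    rw [← ENNReal.toReal_le_toReal (Lp.eLpNorm_ne_top S) ENNReal.coe_ne_top, ← Lp.norm_def]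
    simpa [NNReal.coe_tsum] using hnorm
  · ext x
    have h1 : HasSum (fun i => inner ℂ ((he x).toLp) (L i)) (inner ℂ ((he x).toLp) S) :=
      (hLs.hasSum).mapL (innerSL ℂ ((he x).toLp))
    rw [inner_eq x S (fun ξ => (v ξ : ℂ)⁻¹ * S ξ) (ae_of_all _ fun ξ =>
      (mul_inv_cancel_left₀ (hvne ξ) (S ξ)).symm)] at h1
    have h2 : ∀ i, inner ℂ ((he x).toLp) (L i) = F i x := fun i => by
      rw [inner_eq x (L i) (G i) (hL i).coeFn_toLp, (hG i).eq]
    simp_rw [h2] at h1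
    exact (hf x).unique h1

end InA

/-- Multiplication by `b` maps the algebra to itself, with norm at most `M`. -/
def IsMul (v : V → ℝ) (b : V → ℂ) (M : ℝ≥0) : Prop :=
  ∀ φ K, InA v φ K → InA v (φ * b) (K * M)

namespace IsMul

variable {v : V → ℝ} {C : ℝ≥0} {b b₁ b₂ : V → ℂ} {M M' M₁ M₂ : ℝ≥0}

theorem mono (h : IsMul v b M) (hM : M ≤ M') : IsMul v b M' := fun φ K hφ =>
  (h φ K hφ).mono (by gcongr)

/-- In positive dimension the constant `1` is not in the algebra, but it is a multiplier.
Multipliers thus accommodate zeroth powers. -/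
theorem one (v : V → ℝ) : IsMul v (1 : V → ℂ) 1 := fun φ K hφ => by simpa using hφ

theorem mul (h₁ : IsMul v b₁ M₁) (h₂ : IsMul v b₂ M₂) : IsMul v (b₁ * b₂) (M₁ * M₂) :=
  fun φ K hφ => by
    rw [← mul_assoc, ← mul_assoc]
    exact h₂ _ _ (h₁ _ _ hφ)

theorem pow (h : IsMul v b M) (m : ℕ) : IsMul v (b ^ m) (M ^ m) := by
  induction m with
  | zero => simpa using one v
  | succ m ih => rw [pow_succ, pow_succ]; exact ih.mul h

theorem prod {ι : Type*} (s : Finset ι) {b : ι → V → ℂ} {M : ι → ℝ≥0}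
    (h : ∀ i ∈ s, IsMul v (b i) (M i)) : IsMul v (∏ i ∈ s, b i) (∏ i ∈ s, M i) := by
  classical
  induction s using Finset.induction_on with
  | empty => simpa using one v
  | insert i s hi ih =>
    rw [Finset.prod_insert hi, Finset.prod_insert hi]
    exact (h i (Finset.mem_insert_self _ _)).mul
      (ih fun j hj => h j (Finset.mem_insert_of_mem hj))

theorem const_smul (h : IsMul v b M) (c : ℂ) : IsMul v (c • b) (‖c‖₊ * M) := fun φ K hφ => by
  rw [mul_smul_comm, mul_left_comm]
  exact (h φ K hφ).const_smul c

theorem add (hv : AlgWeight v C) (h₁ : IsMul v b₁ M₁) (h₂ : IsMul v b₂ M₂) :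
    IsMul v (b₁ + b₂) (M₁ + M₂) := fun φ K hφ => by
  rw [mul_add, mul_add]
  exact (h₁ φ K hφ).add hv (h₂ φ K hφ)

theorem sum {ι : Type*} (hv : AlgWeight v C) (s : Finset ι) {b : ι → V → ℂ} {M : ι → ℝ≥0}
    (h : ∀ i ∈ s, IsMul v (b i) (M i)) : IsMul v (∑ i ∈ s, b i) (∑ i ∈ s, M i) := by
  classical
  induction s using Finset.induction_on with
  | empty => exact fun φ K _ => by simpa using ⟨_, HasSpec.zero v⟩
  | insert i s hi ih =>
    rw [Finset.sum_insert hi, Finset.sum_insert hi]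
    exact (h i (Finset.mem_insert_self _ _)).add hv
      (ih fun j hj => h j (Finset.mem_insert_of_mem hj))

/-- The algebra constant is paid once here; multiplier bounds are then submultiplicative with
constant `1`, so powers cost no further factors `C`. -/
theorem of_inA (hv : AlgWeight v C) (h : InA v b M) : IsMul v b (C * M) := fun φ K hφ =>
  (hφ.mul hv h).mono (by rw [mul_left_comm, mul_assoc])

end IsMul

end Algebra

/-! ### Wiener–Lévy weights and the equivalent norms `w^δ + l w` -/

section Weights

variable {V : Type*} [NormedAddCommGroup V] [InnerProductSpace ℝ V] [FiniteDimensional ℝ V]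
  [MeasurableSpace V] [BorelSpace V]

/-- The properties of a Wiener–Lévy weight `w`, with `b` in the role of `⟨·⟩`. -/
structure WLWeight (w b : V → ℝ) (δ A C : ℝ) (N : ℕ) : Prop where
  meas : Measurable w
  pos : ∀ ξ, 0 < w ξ
  b_pos : ∀ ξ, 0 < b ξ
  b_meas : Measurable b
  b_sq_le : ∀ ξ η, b ξ ^ 2 ≤ 2 * b η ^ 2 + 2 * b (ξ - η) ^ 2
  δ_pos : 0 < δ
  δ_lt_one : δ < 1
  A_pos : 0 < A
  C_pos : 0 < C
  growth : ∀ ξ η, w (ξ + η) ≤ A * (1 + ‖ξ‖) ^ N * w η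
  memLp : MemLp (fun ξ => w ξ ^ (-δ)) 2 volume
  conv_le : ∀ ξ, ∫⁻ η, ENNReal.ofReal (1 / (w η ^ δ) ^ 2) * ENNReal.ofReal (1 / (w (ξ - η) ^ δ) ^ 2)
    ≤ ENNReal.ofReal (C ^ 2 / (w ξ ^ δ) ^ 2)
  conv_le' : ∀ ξ, ∫⁻ η, ENNReal.ofReal (1 / (w η ^ δ) ^ 2) *
      ENNReal.ofReal (1 / ((b (ξ - η))⁻¹ * w (ξ - η)) ^ 2)
    ≤ ENNReal.ofReal (C ^ 2 / ((b ξ)⁻¹ * w ξ) ^ 2)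

namespace WLWeight

variable {w b : V → ℝ} {δ A C : ℝ} {N : ℕ}

/-- The growth condition makes `w` vary by at most a fixed factor on a unit ball, so a value of
`w^{-2δ}` is controlled by its mean there. This converts `w^{-δ} ∈ L²` into pointwise information.
-/
theorem rpow_sq_le_setIntegral (hw : WLWeight w b δ A C N) :
    ∃ B : ℝ, 0 < B ∧ ∀ ξ,
      (w ξ ^ (-δ)) ^ 2 ≤ B * ∫ η in Metric.ball ξ 1, (w η ^ (-δ)) ^ 2 := by
  set A' : ℝ := A * 2 ^ N with hA'
  have hA'pos : 0 < A' := by have := hw.A_pos; positivity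
  set m : ℝ := (volume : Measure V).real (Metric.ball 0 1) with hm
  have hmpos : 0 < m := ENNReal.toReal_pos (Metric.measure_ball_pos _ _ one_pos).ne' measure_ball_lt_top.ne
  have hmξ : ∀ ξ : V, (volume : Measure V).real (Metric.ball ξ 1) = m := fun ξ => by
    rw [hm, measureReal_def, measureReal_def, Measure.addHaar_ball_center]
  have hInt : Integrable (fun η => (w η ^ (-δ)) ^ 2) volume := hw.memLp.integrable_sq
  refine ⟨(A' ^ δ) ^ 2 / m, by positivity, fun ξ => ?_⟩
  have key : ∀ η ∈ Metric.ball ξ 1, (w ξ ^ (-δ)) ^ 2 ≤ (A' ^ δ) ^ 2 * (w η ^ (-δ)) ^ 2 := by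
    intro η hη
    have h1 : w η ≤ A' * w ξ := by
      have h := hw.growth (η - ξ) ξ
      rw [sub_add_cancel] at h
      refine h.trans ?_
      have h2 : ‖η - ξ‖ ≤ 1 := by rw [← dist_eq_norm]; exact (Metric.mem_ball.1 hη).le
      have := hw.A_pos
      have := (hw.pos ξ).le
      rw [hA']
      gcongr
      linarith
    rw [← mul_pow]
    have p1 := hw.pos ξ
    have p2 := hw.pos η
    gcongr
    rw [Real.rpow_neg p1.le, Real.rpow_neg p2.le, ← div_eq_mul_inv, inv_le_comm₀ (by positivity)
      (by positivity), inv_div, div_le_iff₀ (by positivity), mul_comm,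
      ← Real.mul_rpow hA'pos.le p1.le]
    exact Real.rpow_le_rpow p2.le h1 hw.δ_pos.le
  have h := setIntegral_mono_on (μ := volume) (s := Metric.ball ξ 1)
    (f := fun _ => (w ξ ^ (-δ)) ^ 2) (g := fun η => (A' ^ δ) ^ 2 * (w η ^ (-δ)) ^ 2)
    (integrableOn_const (by simpa using measure_ball_lt_top.ne))
    (hInt.const_mul _).integrableOn measurableSet_ball key
  rw [setIntegral_const, hmξ, smul_eq_mul, integral_const_mul] at h
  rw [div_mul_eq_mul_div, le_div_iff₀ hmpos]
  linarith

theorem exists_le (hw : WLWeight w b δ A C N) : ∃ c : ℝ, 0 < c ∧ ∀ ξ, c ≤ w ξ := by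
  obtain ⟨B, hB, h⟩ := hw.rpow_sq_le_setIntegral
  set I := ∫ η, (w η ^ (-δ)) ^ 2 with hI
  have hI0 : 0 ≤ I := integral_nonneg fun _ => by positivity
  have hInt : Integrable (fun η => (w η ^ (-δ)) ^ 2) volume := hw.memLp.integrable_sq
  have hs : ∀ ξ, w ξ ^ (-δ) ≤ Real.sqrt (B * I) + 1 := fun ξ => by
    have h1 : (w ξ ^ (-δ)) ^ 2 ≤ B * I := (h ξ).trans (by
      gcongr
      exact setIntegral_le_integral hInt (ae_of_all _ fun _ => by positivity))
    have h2 := Real.le_sqrt_of_sq_le h1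
    linarith
  set S := Real.sqrt (B * I) + 1 with hS
  have hSpos : 0 < S := by positivity
  have hδ := hw.δ_pos
  refine ⟨S ^ (-δ⁻¹), by positivity, fun ξ => ?_⟩
  have p := hw.pos ξ
  have h1 := Real.rpow_le_rpow_of_nonpos (x := w ξ ^ (-δ)) (y := S) (z := -δ⁻¹)
    (by positivity) (hs ξ) (by simpa using hδ.le)
  rwa [← Real.rpow_mul p.le, neg_mul_neg, mul_inv_cancel₀ hδ.ne', Real.rpow_one] at h1

/-- The integral of `w^{-2δ}` outside large balls tends to zero, and with it the means over unit
balls far from the origin. -/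
theorem exists_le_of_norm_ge (hw : WLWeight w b δ A C N) {T : ℝ} (hT : 0 < T) :
    ∃ R : ℝ, 0 < R ∧ ∀ ξ, R ≤ ‖ξ‖ → T ≤ w ξ := by
  obtain ⟨B, hB, h⟩ := hw.rpow_sq_le_setIntegral
  have hInt : Integrable (fun η => (w η ^ (-δ)) ^ 2) volume := hw.memLp.integrable_sq
  have hanti : Antitone fun m : ℕ => (Metric.closedBall (0 : V) m)ᶜ := fun m m' hm =>
    Set.compl_subset_compl.2 (Metric.closedBall_subset_closedBall (by exact_mod_cast hm))
  have hlim := tendsto_setIntegral_of_antitone (μ := volume)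
    (f := fun η => (w η ^ (-δ)) ^ 2) (fun m : ℕ => Metric.isClosed_closedBall.measurableSet.compl)
    hanti ⟨0, hInt.integrableOn⟩
  have hempty : ⋂ m : ℕ, (Metric.closedBall (0 : V) m)ᶜ = ∅ := by
    rw [← Set.compl_iUnion, Metric.iUnion_closedBall_nat, Set.compl_univ]
  rw [hempty] at hlim
  simp only [Measure.restrict_empty, integral_zero_measure] at hlim
  have hε : 0 < (T ^ (-δ)) ^ 2 / B := by positivity
  obtain ⟨m, hm⟩ := (hlim.eventually (gt_mem_nhds hε)).exists
  refine ⟨m + 2, by positivity, fun ξ hξ => ?_⟩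
  have hsub : Metric.ball ξ 1 ⊆ (Metric.closedBall (0 : V) m)ᶜ := by
    intro η hη hη'
    have h1 : ‖η‖ ≤ m := by simpa using hη'
    have h2 : ‖ξ - η‖ < 1 := by rw [norm_sub_rev, ← dist_eq_norm]; exact Metric.mem_ball.1 hη
    have h3 : ‖ξ‖ ≤ ‖ξ - η‖ + ‖η‖ := by simpa using norm_add_le (ξ - η) η
    linarith
  have h1 : (w ξ ^ (-δ)) ^ 2 ≤ (T ^ (-δ)) ^ 2 := by
    refine (h ξ).trans ?_
    have := setIntegral_mono_set hInt.integrableOn (ae_of_all _ fun _ => by positivity)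
      hsub.eventuallyLE
    rw [lt_div_iff₀ hB] at hm
    nlinarith
  have p := hw.pos ξ
  have h2 : w ξ ^ (-δ) ≤ T ^ (-δ) := by
    refine le_of_sq_le_sq h1 (by positivity)
  exact (Real.rpow_le_rpow_iff_of_neg p hT (by simpa using hw.δ_pos)).1 h2

/-- For large frequencies, `w^δ` is small compared to `w`. -/
theorem exists_rpow_le (hw : WLWeight w b δ A C N) {ε : ℝ} (hε : 0 < ε) :
    ∃ R : ℝ, 0 < R ∧ ∀ ξ, R ≤ ‖ξ‖ → w ξ ^ δ ≤ ε * w ξ := by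
  have hδ : 0 < 1 - δ := by linarith [hw.δ_lt_one]
  obtain ⟨R, hR, h⟩ := hw.exists_le_of_norm_ge (T := ε ^ (-(1 - δ)⁻¹)) (by positivity)
  refine ⟨R, hR, fun ξ hξ => ?_⟩
  have p := hw.pos ξ
  have h1 := Real.rpow_le_rpow_of_nonpos (z := -(1 - δ)) (by positivity) (h ξ hξ) (by linarith)
  rw [← Real.rpow_mul hε.le, neg_mul_neg, inv_mul_cancel₀ hδ.ne', Real.rpow_one] at h1
  calc w ξ ^ δ = w ξ ^ (-(1 - δ)) * w ξ := by
        rw [← Real.rpow_add_one p.ne']; congr 1; ring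
    _ ≤ _ := by gcongr

theorem exists_rpow_le_all (hw : WLWeight w b δ A C N) :
    ∃ B : ℝ, 0 < B ∧ ∀ ξ, w ξ ^ δ ≤ B * w ξ := by
  obtain ⟨c, hc, h⟩ := hw.exists_le
  refine ⟨c ^ (-(1 - δ)), by positivity, fun ξ => ?_⟩
  have p := hw.pos ξ
  have h1 := Real.rpow_le_rpow_of_nonpos (z := -(1 - δ)) hc (h ξ) (by linarith [hw.δ_lt_one])
  calc w ξ ^ δ = w ξ ^ (-(1 - δ)) * w ξ := by
        rw [← Real.rpow_add_one p.ne']; congr 1; ring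
    _ ≤ _ := by gcongr

/-- The weights `w^δ + l w`, `l > 0`, define algebras with constants independent of `l`. -/
theorem algWeight (hw : WLWeight w b δ A C N) :
    ∃ K : ℝ≥0, 0 < K ∧ ∀ l : ℝ, 0 < l → AlgWeight (fun ξ => w ξ ^ δ + l * w ξ) K := by
  set K₀ : ℝ≥0 := (eLpNorm (fun ξ => w ξ ^ (-δ)) 2 volume).toNNReal with hK₀
  have hC := hw.C_pos
  -- `K₀` bounds the norm of `v⁻¹`, since `v ≥ w^δ`; the summand `4C` serves the convolution
  -- inequality. Neither depends on `l`.
  refine ⟨K₀ + Real.toNNReal (4 * C), add_pos_of_nonneg_of_pos zero_le 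
    (Real.toNNReal_pos.2 (mul_pos four_pos hC)), fun l hl => ?_⟩
  have hp : ∀ ξ, 0 < w ξ ^ δ := fun ξ => Real.rpow_pos_of_pos (hw.pos ξ) δ
  have hpl : ∀ ξ, 0 < l * w ξ := fun ξ => mul_pos hl (hw.pos ξ)
  have hmδ : Measurable fun ξ => w ξ ^ δ := hw.meas.pow_const δ
  refine ⟨hmδ.add (hw.meas.const_mul l), fun ξ => add_pos (hp ξ) (hpl ξ), ?_, ?_⟩
  · have h1 : eLpNorm (fun ξ => (((w ξ ^ δ + l * w ξ : ℝ) : ℂ))⁻¹) 2 volume ≤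
        eLpNorm (fun ξ => w ξ ^ (-δ)) 2 volume := by
      refine eLpNorm_mono fun ξ => ?_
      rw [norm_inv, Complex.norm_real, Real.norm_of_nonneg (add_pos (hp ξ) (hpl ξ)).le,
        Real.rpow_neg (hw.pos ξ).le, norm_inv, Real.norm_of_nonneg (hp ξ).le]
      exact inv_anti₀ (hp ξ) (by linarith [hpl ξ])
    refine h1.trans ?_
    rw [← ENNReal.coe_toNNReal hw.memLp.2.ne]
    exact_mod_cast le_self_add
  · intro ξ
    set v : V → ℝ := fun ξ => w ξ ^ δ + l * w ξ with hv
    have hvp : ∀ ξ, 0 < v ξ := fun ξ => add_pos (hp ξ) (hpl ξ)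
    have inv1 : ∀ η, 1 / v η ^ 2 ≤ 1 / (w η ^ δ) ^ 2 := fun η => by
      have := hp η
      have := hpl η
      gcongr
      simp only [hv]
      linarith
    have inv2 : ∀ η, 1 / v η ^ 2 ≤ 1 / (l * w η) ^ 2 := fun η => by
      have := hp η
      have := hpl η
      gcongr
      simp only [hv]
      linarith
    have bd1 : ∫⁻ η, ENNReal.ofReal (1 / v η ^ 2) * ENNReal.ofReal (1 / v (ξ - η) ^ 2)
        ≤ ENNReal.ofReal (C ^ 2 / (w ξ ^ δ) ^ 2) := by
      refine le_trans (lintegral_mono fun η => ?_) (hw.conv_le ξ)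
      exact mul_le_mul' (ENNReal.ofReal_le_ofReal (inv1 _)) (ENNReal.ofReal_le_ofReal (inv1 _))
    set f : V → ℝ≥0∞ := fun η => ENNReal.ofReal (1 / (w η ^ δ) ^ 2) *
      ENNReal.ofReal (1 / ((b (ξ - η))⁻¹ * w (ξ - η)) ^ 2) with hf
    have hfm : Measurable f := by
      refine Measurable.fun_mul ?_ ?_
      · exact (measurable_const.div (hmδ.pow_const 2)).ennreal_ofReal
      · have : Measurable fun η => 1 / ((b η)⁻¹ * w η) ^ 2 :=
          measurable_const.div ((hw.b_meas.inv.mul hw.meas).pow_const 2)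
        exact (this.comp (measurable_const.sub measurable_id)).ennreal_ofReal
    have bd2 : ∫⁻ η, ENNReal.ofReal (1 / v η ^ 2) * ENNReal.ofReal (1 / v (ξ - η) ^ 2)
        ≤ ENNReal.ofReal (4 * C ^ 2 / (l * w ξ) ^ 2) := by
      have hbξ := hw.b_pos ξ
      -- Insert `b(ξ)² ≤ 2b(η)² + 2b(ξ - η)²`. In each half the factor carrying `b` is estimated
      -- through `v ≥ l w` and the other through `v ≥ w^δ`, which gives the integrand of `conv_le'`
      -- or its reflection `η ↦ ξ - η`.
      have pt : ∀ η, ENNReal.ofReal (1 / v η ^ 2) * ENNReal.ofReal (1 / v (ξ - η) ^ 2) ≤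
          ENNReal.ofReal (2 / (l * b ξ) ^ 2) * (f (ξ - η) + f η) := by
        intro η
        have hbη := hw.b_pos η
        have hbη' := hw.b_pos (ξ - η)
        have hwη := hw.pos η
        have hwη' := hw.pos (ξ - η)
        have hpη := hp η
        have hpη' := hp (ξ - η)
        simp only [hf, sub_sub_cancel]
        rw [← ENNReal.ofReal_mul (by positivity), ← ENNReal.ofReal_mul (by positivity),
          ← ENNReal.ofReal_mul (by positivity), ← ENNReal.ofReal_add (by positivity)
          (by positivity), ← ENNReal.ofReal_mul (by positivity)]
        refine ENNReal.ofReal_le_ofReal ?_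
        have hvη : 0 ≤ 1 / v η ^ 2 := by positivity
        have hvη' : 0 ≤ 1 / v (ξ - η) ^ 2 := by positivity
        have e1 : 1 / v η ^ 2 * (1 / v (ξ - η) ^ 2) ≤ 1 / (l * w η) ^ 2 * (1 / (w (ξ - η) ^ δ) ^ 2) :=
          mul_le_mul (inv2 η) (inv1 _) hvη' (by positivity)
        have e2 : 1 / v η ^ 2 * (1 / v (ξ - η) ^ 2) ≤ 1 / (w η ^ δ) ^ 2 * (1 / (l * w (ξ - η)) ^ 2) :=
          mul_le_mul (inv1 η) (inv2 _) hvη' (by positivity)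
        have hb := hw.b_sq_le ξ η
        calc 1 / v η ^ 2 * (1 / v (ξ - η) ^ 2)
            = 1 / b ξ ^ 2 * (b ξ ^ 2 * (1 / v η ^ 2 * (1 / v (ξ - η) ^ 2))) := by
              field_simp
          _ ≤ 1 / b ξ ^ 2 * ((2 * b η ^ 2 + 2 * b (ξ - η) ^ 2) *
              (1 / v η ^ 2 * (1 / v (ξ - η) ^ 2))) := by
              gcongr
          _ ≤ 1 / b ξ ^ 2 * (2 * b η ^ 2 * (1 / (l * w η) ^ 2 * (1 / (w (ξ - η) ^ δ) ^ 2)) +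
              2 * b (ξ - η) ^ 2 * (1 / (w η ^ δ) ^ 2 * (1 / (l * w (ξ - η)) ^ 2))) := by
              rw [add_mul]
              gcongr
          _ = _ := by
              field_simp
      have fle : ∫⁻ η, f η ≤ ENNReal.ofReal (C ^ 2 / ((b ξ)⁻¹ * w ξ) ^ 2) := hw.conv_le' ξ
      calc _ ≤ ∫⁻ η, ENNReal.ofReal (2 / (l * b ξ) ^ 2) * (f (ξ - η) + f η) := lintegral_mono pt
        _ = ENNReal.ofReal (2 / (l * b ξ) ^ 2) * ∫⁻ η, (f (ξ - η) + f η) := by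
            rw [lintegral_const_mul' _ _ ENNReal.ofReal_ne_top]
        _ = ENNReal.ofReal (2 / (l * b ξ) ^ 2) * ((∫⁻ η, f η) + ∫⁻ η, f η) := by
            rw [lintegral_add_right _ hfm, lintegral_sub_left_eq_self f ξ]
        _ ≤ ENNReal.ofReal (2 / (l * b ξ) ^ 2) *
              (ENNReal.ofReal (C ^ 2 / ((b ξ)⁻¹ * w ξ) ^ 2) +
                ENNReal.ofReal (C ^ 2 / ((b ξ)⁻¹ * w ξ) ^ 2)) := by
            gcongr
        _ = _ := by
            have hwξ := hw.pos ξ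
            rw [← ENNReal.ofReal_add (by positivity) (by positivity),
              ← ENNReal.ofReal_mul (by positivity)]
            congr 1
            field_simp
            norm_num
    have hpξ := hp ξ
    have hplξ := hpl ξ
    have hvξ := hvp ξ
    have hKC : (4 * C) ^ 2 ≤ ((K₀ + Real.toNNReal (4 * C) : ℝ≥0) : ℝ) ^ 2 := by
      gcongr
      push_cast
      rw [Real.coe_toNNReal _ (by positivity)]
      exact le_add_of_nonneg_left K₀.coe_nonneg
    -- `v(ξ)` is at most twice the larger of its two terms `p`, so the bound belonging to that term
    -- suffices; `4C² · 4 = (4C)²` explains the constant.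
    have fin : ∀ D p : ℝ, 0 < p → v ξ ≤ 2 * p → D ≤ 4 * C ^ 2 →
        D / p ^ 2 ≤ ((K₀ + Real.toNNReal (4 * C) : ℝ≥0) : ℝ) ^ 2 / v ξ ^ 2 := by
      intro D p hpp hvp' hD
      rw [div_le_div_iff₀ (by positivity) (by positivity)]
      have h1 : v ξ ^ 2 ≤ 4 * p ^ 2 := by nlinarith
      calc D * v ξ ^ 2 ≤ 4 * C ^ 2 * (4 * p ^ 2) := by gcongr
        _ = (4 * C) ^ 2 * p ^ 2 := by ring
        _ ≤ _ := by gcongr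
    rcases le_total (l * w ξ) (w ξ ^ δ) with hcase | hcase
    · refine bd1.trans (ENNReal.ofReal_le_ofReal (fin _ _ hpξ ?_ (by nlinarith)))
      simp only [hv]
      linarith
    · refine bd2.trans (ENNReal.ofReal_le_ofReal (fin _ _ hplξ ?_ le_rfl))
      simp only [hv]
      linarith

end WLWeight

end Weights

/-! ### Plancherel, band-limited functions and the growth of powers -/

section Powers

variable {V : Type*} [NormedAddCommGroup V] [InnerProductSpace ℝ V] [FiniteDimensional ℝ V]
  [MeasurableSpace V] [BorelSpace V]

theorem integral_fourierInv_mul_eq {f g : V → ℂ} (hf : Integrable f) (hg : Integrable g) :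
    ∫ ξ, 𝓕⁻ f ξ * g ξ = ∫ x, f x * 𝓕⁻ g x := by
  have hc : Continuous fun p : V × V => (-innerₗ V) p.1 p.2 := by
    have : Continuous fun p : V × V => -(inner ℝ p.1 p.2 : ℝ) := by fun_prop
    exact this
  have h := VectorFourier.integral_fourierIntegral_smul_eq_flip (L := -innerₗ V)
    Real.continuous_fourierChar hc hf hg
  have hflip : (-innerₗ V).flip = -innerₗ V := by
    ext x y
    simp [real_inner_comm]
  rw [hflip] at h
  exact h

theorem continuous_fourierInv {f : V → ℂ} (hf : Integrable f) : Continuous (𝓕⁻ f) := by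
  have hc : Continuous fun p : V × V => (-innerₗ V) p.1 p.2 := by
    have : Continuous fun p : V × V => -(inner ℝ p.1 p.2 : ℝ) := by fun_prop
    exact this
  exact VectorFourier.fourierIntegral_continuous Real.continuous_fourierChar hc hf

/-- Plancherel's identity for integrable, square integrable functions. -/
theorem eLpNorm_fourierInv {G : V → ℂ} (h1 : Integrable G) (h2 : MemLp G 2 volume) :
    eLpNorm (𝓕⁻ G) 2 volume = eLpNorm G 2 volume := by
  -- The `L²` inverse transform and the inversion integral agree almost everywhere because they
  -- agree against test functions.
  have key : ((𝓕⁻ (h2.toLp) : Lp ℂ 2 (volume : Measure V)) : V → ℂ) =ᵐ[volume] 𝓕⁻ G := by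
    refine ae_eq_of_integral_contDiff_smul_eq
      ((Lp.memLp _).locallyIntegrable (by norm_num))
      (continuous_fourierInv h1).locallyIntegrable fun g hg hgs => ?_
    have hgc : HasCompactSupport (fun x => (g x : ℂ)) := hgs.comp_left (g := fun t : ℝ => (t : ℂ)) rfl
    let φ : 𝓢(V, ℂ) := hgc.toSchwartzMap (Complex.ofRealCLM.contDiff.comp hg)
    have hφ : ∀ x, φ x = (g x : ℂ) := fun x => rfl
    have e := congrArg (fun T : 𝓢'(V, ℂ) => T φ)
      (Lp.fourierInv_toTemperedDistribution_eq (h2.toLp))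
    simp only [TemperedDistribution.fourierInv_apply, Lp.toTemperedDistribution_apply] at e
    have e1 : ∀ H : V → ℂ, ∫ x, g x • H x = ∫ x, φ x • H x := fun H => by
      simp [hφ]
    rw [e1, e1, ← e]
    have e2 : ∫ x, (𝓕⁻ φ) x • (h2.toLp) x = ∫ x, 𝓕⁻ (φ : V → ℂ) x * G x := by
      refine integral_congr_ae ?_
      filter_upwards [h2.coeFn_toLp] with x hx
      rw [hx, SchwartzMap.fourierInv_coe]
      rfl
    rw [e2, integral_fourierInv_mul_eq φ.integrable h1]
    rfl
  rw [← eLpNorm_congr_ae key]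
  have hn : ‖(𝓕⁻ (h2.toLp) : Lp ℂ 2 (volume : Measure V))‖ = ‖h2.toLp‖ :=
    (Lp.fourierTransformₗᵢ V ℂ).symm.norm_map _
  rw [Lp.norm_def, Lp.norm_def] at hn
  rw [(ENNReal.toReal_eq_toReal_iff' (Lp.eLpNorm_ne_top _) (Lp.eLpNorm_ne_top _)).1 hn]
  exact eLpNorm_congr_ae h2.coeFn_toLp

namespace AlgWeight

variable {v : V → ℝ} {C : ℝ≥0} {a G : V → ℂ} {M R P L s : ℝ≥0} {N : ℕ}

/-- Supports add under convolution. The bound `Mj` only supplies finiteness; the quantitative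
estimate comes from Plancherel. -/
theorem hasSpec_pow_bandlimited (hv : AlgWeight v C) (ha : HasSpec v a G M)
    (hR : ∀ ξ, R < ‖ξ‖ → G ξ = 0) (j : ℕ) :
    ∃ Gj Mj, HasSpec v (a ^ (j + 1)) Gj Mj ∧ ∀ ξ, (j + 1) * R < ‖ξ‖ → Gj ξ = 0 := by
  induction j with
  | zero => exact ⟨G, M, by simpa using ha, by simpa using hR⟩
  | succ j ih =>
    obtain ⟨Gj, Mj, h, h0⟩ := ih
    refine ⟨_, _, by rw [pow_succ]; exact hv.hasSpec_mul h ha, fun ξ hξ => ?_⟩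
    refine integral_eq_zero_of_ae (ae_of_all _ fun η => ?_)
    simp only [ContinuousLinearMap.mul_apply', Pi.zero_apply, mul_eq_zero]
    by_contra! hne
    have h1 : ‖η‖ ≤ (j + 1) * R := not_lt.1 fun h => hne.1 (h0 η h)
    have h2 : ‖ξ - η‖ ≤ R := not_lt.1 fun h => hne.2 (hR _ h)
    have h3 : ‖ξ‖ ≤ ‖ξ - η‖ + ‖η‖ := by simpa using norm_add_le (ξ - η) η
    push_cast at hξ
    linarith

/-- Powers of a band-limited function are controlled by its sup norm. -/
theorem inA_pow_bandlimited (hv : AlgWeight v C) (ha : HasSpec v a G M)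
    (hR : ∀ ξ, R < ‖ξ‖ → G ξ = 0) (hvc : ∃ c : ℝ, 0 < c ∧ ∀ ξ, c ≤ v ξ)
    (hP : ∀ ξ, v ξ ≤ P * (1 + ‖ξ‖) ^ N) (hL : eLpNorm G 2 volume ≤ L) (hs : ∀ x, ‖a x‖ ≤ s)
    (j : ℕ) : InA v (a ^ (j + 1)) (P * (1 + (j + 1) * R) ^ N * (s ^ j * L)) := by
  obtain ⟨c, hc, hvc⟩ := hvc
  have memLp : ∀ {f F : V → ℂ} {K : ℝ≥0}, HasSpec v f F K → MemLp F 2 volume := by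
    intro f F K h
    have hm : MemLp (fun ξ => (v ξ : ℂ) * F ξ) 2 volume :=
      ⟨((Complex.measurable_ofReal.comp hv.meas).aestronglyMeasurable).mul h.meas,
        h.norm_le.trans_lt ENNReal.coe_lt_top⟩
    refine hm.of_le_mul (c := c⁻¹) h.meas (ae_of_all _ fun ξ => ?_)
    rw [norm_mul, Complex.norm_real, Real.norm_of_nonneg (hv.pos ξ).le, ← mul_assoc]
    refine le_mul_of_one_le_left (norm_nonneg _) ?_
    rw [inv_mul_eq_div, one_le_div hc]
    exact hvc ξ
  obtain ⟨Gj, Mj, hj, h0⟩ := hv.hasSpec_pow_bandlimited ha hR j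
  -- Pass to the `x` side, where `|a^{j+1}| ≤ s^j |a|` pointwise, and return by Plancherel.
  have hGj : eLpNorm Gj 2 volume ≤ (s ^ j * L : ℝ≥0) := by
    have e1 := eLpNorm_fourierInv (hv.integrable hj) (memLp hj)
    have e2 := eLpNorm_fourierInv (hv.integrable ha) (memLp ha)
    rw [← hj.eq] at e1
    rw [← ha.eq] at e2
    rw [← e1]
    have h1 : eLpNorm (a ^ (j + 1)) 2 volume ≤ (s ^ j) • eLpNorm a 2 volume := by
      refine eLpNorm_le_nnreal_smul_eLpNorm_of_ae_le_mul (ae_of_all _ fun x => ?_) _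
      rw [Pi.pow_apply, nnnorm_pow, pow_succ]
      gcongr
      exact hs x
    refine h1.trans ?_
    rw [e2, ENNReal.smul_def, smul_eq_mul, ENNReal.coe_mul]
    gcongr
  refine ⟨Gj, hj.meas, ?_, hj.eq⟩
  have h1 : eLpNorm (fun ξ => (v ξ : ℂ) * Gj ξ) 2 volume ≤
      (P * (1 + (j + 1) * R) ^ N) • eLpNorm Gj 2 volume := by
    refine eLpNorm_le_nnreal_smul_eLpNorm_of_ae_le_mul (ae_of_all _ fun ξ => ?_) _
    rw [← NNReal.coe_le_coe]
    push_cast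
    rw [norm_mul, Complex.norm_real, Real.norm_of_nonneg (hv.pos ξ).le]
    by_cases hξ : (j + 1) * R < ‖ξ‖
    · simp [h0 ξ hξ]
    · push Not at hξ
      gcongr
      refine (hP ξ).trans ?_
      gcongr
  refine h1.trans ?_
  rw [ENNReal.smul_def, smul_eq_mul, ENNReal.coe_mul (P * _)]
  gcongr

end AlgWeight

/-- The polynomial loss from the growing spectrum of `a^j` is absorbed by raising the geometric
ratio from `3` to `4`. -/
theorem exists_poly_mul_geom_le (R : ℝ≥0) (N : ℕ) :
    ∃ D : ℝ≥0, ∀ m : ℕ, (1 + m * R) ^ N * 3 ^ m ≤ D * 4 ^ m := by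
  have h := tendsto_pow_const_mul_const_pow_of_abs_lt_one N (r := (3 / 4 : ℝ))
    (by rw [abs_of_pos] <;> norm_num)
  obtain ⟨B, hB⟩ := h.bddAbove_range
  have hB' : ∀ m : ℕ, (m : ℝ) ^ N * (3 / 4) ^ m ≤ B := fun m => hB ⟨m, rfl⟩
  have hB0 : 0 ≤ B := le_trans (by positivity) (hB' 1)
  refine ⟨(1 + R) ^ N * (Real.toNNReal B * (4 / 3)), fun m => ?_⟩
  rw [← NNReal.coe_le_coe]
  push_cast
  rw [Real.coe_toNNReal _ hB0]
  have h1 : (1 + (m : ℝ) * R) ≤ (1 + R) * (m + 1 : ℕ) := by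
    push_cast
    nlinarith [R.coe_nonneg, (Nat.cast_nonneg m : (0 : ℝ) ≤ m)]
  have h2 := hB' (m + 1)
  have h3 : ((m + 1 : ℕ) : ℝ) ^ N * 3 ^ m ≤ B * (4 / 3) * 4 ^ m := by
    rw [pow_succ, div_pow] at h2
    have h4 : (0 : ℝ) < 4 ^ m := by positivity
    have h5 : ((m + 1 : ℕ) : ℝ) ^ N * 3 ^ m =
        (((m + 1 : ℕ) : ℝ) ^ N * (3 ^ m / 4 ^ m * (3 / 4))) * (4 / 3) * 4 ^ m := by
      field_simp
    rw [h5]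
    gcongr
  calc (1 + (m : ℝ) * R) ^ N * 3 ^ m ≤ ((1 + R) * (m + 1 : ℕ)) ^ N * 3 ^ m := by gcongr
    _ = (1 + R) ^ N * (((m + 1 : ℕ) : ℝ) ^ N * 3 ^ m) := by rw [mul_pow]; ring
    _ ≤ (1 + R) ^ N * (B * (4 / 3) * 4 ^ m) := by gcongr
    _ = _ := by ring

namespace WLWeight

variable {w b : V → ℝ} {δ A C : ℝ} {N : ℕ}

/-- The spectral radius estimate: in a suitable equivalent norm, the powers of `g` grow like those
of a multiple of its sup norm. -/
theorem exists_isMul_pow (hw : WLWeight w b δ A C N) {σ : ℝ≥0} (hσ : 0 < σ) (M : ℝ≥0) :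
    ∃ l : ℝ, 0 < l ∧ ∃ D : ℝ≥0, ∀ g : V → ℂ, InA w g M → (∀ x, ‖g x‖ ≤ σ) → ∀ m : ℕ,
      IsMul (fun ξ => w ξ ^ δ + l * w ξ) (g ^ m) (D * (4 * σ) ^ m) := by
  obtain ⟨K, hK, hAlg⟩ := hw.algWeight
  obtain ⟨B, hB, hBle⟩ := hw.exists_rpow_le_all
  obtain ⟨c, hc, hcle⟩ := hw.exists_le
  -- Chosen so that `K · 2l · M ≤ σ`: the high-frequency part, whose `v`-norm is at most `2lM`, acts
  -- as a multiplier of norm at most `σ`. Using `M + 1` covers `M = 0`.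
  set l : ℝ≥0 := σ / (2 * K * (M + 1)) with hl
  have hlpos : 0 < l := by positivity
  obtain ⟨R, hR, hRle⟩ := hw.exists_rpow_le (ε := l) (by exact_mod_cast hlpos)
  lift R to ℝ≥0 using hR.le
  lift B to ℝ≥0 using hB.le
  lift c to ℝ≥0 using hc.le
  set v : V → ℝ := fun ξ => w ξ ^ δ + l * w ξ with hvdef
  have hv : AlgWeight v K := hAlg l (by exact_mod_cast hlpos)
  have hvle : ∀ ξ, v ξ ≤ (B + l : ℝ≥0) * w ξ := fun ξ => by
    push_cast
    rw [add_mul]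
    exact add_le_add (hBle ξ) le_rfl
  set P : ℝ≥0 := (B + l) * Real.toNNReal (A * w 0) with hP
  have hPle : ∀ ξ, v ξ ≤ P * (1 + ‖ξ‖) ^ N := fun ξ => by
    refine (hvle ξ).trans ?_
    have h1 := hw.growth ξ 0
    rw [add_zero] at h1
    rw [hP]
    push_cast
    rw [Real.coe_toNNReal _ (mul_pos hw.A_pos (hw.pos 0)).le, mul_assoc]
    gcongr
    linarith
  have hvc : ∃ c' : ℝ, 0 < c' ∧ ∀ ξ, c' ≤ v ξ := by
    refine ⟨l * c, by positivity, fun ξ => ?_⟩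
    have h1 : 0 < w ξ ^ δ := Real.rpow_pos_of_pos (hw.pos ξ) δ
    have h2 : (l : ℝ) * c ≤ l * w ξ := by gcongr; exact hcle ξ
    simp only [hvdef]
    linarith
  set L : ℝ≥0 := c⁻¹ * M with hL
  -- The `1` serves `j = 0`. For `j ≥ 1` Plancherel yields only `j - 1` factors `2σ`, and dividing
  -- by `2σ` restores the exponent `j`. All constants are fixed before `g`, hence uniform in `g`.
  set Q : ℝ≥0 := 1 + K * P * L / (2 * σ) with hQ
  obtain ⟨D, hD⟩ := exists_poly_mul_geom_le R N
  refine ⟨l, by exact_mod_cast hlpos, Q * D, fun g hg hgσ m => ?_⟩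
  obtain ⟨G, hG⟩ := hg
  set E : Set V := {ξ | (R : ℝ) < ‖ξ‖} with hE
  have hEm : MeasurableSet E := measurableSet_lt measurable_const measurable_norm
  set H : V → ℂ := E.indicator G with hH
  set G' : V → ℂ := Eᶜ.indicator G with hG'
  have hGsum : G' + H = G := Set.indicator_compl_add_self E G
  have specH : HasSpec v (𝓕⁻ H) H ((l + l) * M) := by
    refine ⟨hG.meas.indicator hEm, ?_, rfl⟩
    have h1 : eLpNorm (fun ξ => (v ξ : ℂ) * H ξ) 2 volume ≤
        (l + l) • eLpNorm (fun ξ => (w ξ : ℂ) * G ξ) 2 volume := by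
      refine eLpNorm_le_nnreal_smul_eLpNorm_of_ae_le_mul (ae_of_all _ fun ξ => ?_) _
      rw [← NNReal.coe_le_coe]
      push_cast
      rw [norm_mul, norm_mul, Complex.norm_real, Complex.norm_real,
        Real.norm_of_nonneg (hv.pos ξ).le, Real.norm_of_nonneg (hw.pos ξ).le, ← mul_assoc]
      by_cases hξ : ξ ∈ E
      · rw [hH, Set.indicator_of_mem hξ]
        gcongr
        rw [add_mul]
        exact add_le_add (hRle ξ (le_of_lt hξ)) le_rfl
      · rw [hH, Set.indicator_of_notMem hξ, norm_zero, mul_zero]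
        have := (hw.pos ξ).le
        positivity
    refine h1.trans ?_
    rw [ENNReal.smul_def, smul_eq_mul, ENNReal.coe_mul]
    gcongr
    exact hG.norm_le
  have specG' : HasSpec v (𝓕⁻ G') G' ((B + l) * M) := by
    have h0 := (hG.of_weight_le (fun ξ => (hv.pos ξ).le) hvle)
    refine ⟨hG.meas.indicator hEm.compl, le_trans (eLpNorm_mono fun ξ => ?_) h0.norm_le, rfl⟩
    rw [norm_mul, norm_mul]
    gcongr
    exact norm_indicator_le_norm_self _ _
  set a : V → ℂ := 𝓕⁻ G' with ha
  set h : V → ℂ := 𝓕⁻ H with hh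
  have hgah : g = a + h := by
    rw [hG.eq, ← hGsum]
    exact (hv.hasSpec_add specG' specH).eq.symm
  have hKl : K * ((l + l) * M) ≤ σ := by
    have : K * ((l + l) * M) = σ * (M / (M + 1)) := by
      rw [hl]; field_simp; ring
    rw [this]
    exact mul_le_of_le_one_right zero_le (div_le_one_of_le₀ le_self_add zero_le)
  have hhσ : ∀ x, ‖h x‖ ≤ σ := fun x => (hv.norm_apply_le specH x).trans (by exact_mod_cast hKl)
  -- A sharp frequency cutoff need not preserve sup bounds; here `a = g - h`, and `h` is bounded by
  -- its small algebra norm.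
  have haσ : ∀ x, ‖a x‖ ≤ (2 * σ : ℝ≥0) := fun x => by
    have : a x = g x - h x := by rw [hgah]; simp
    rw [this]
    push_cast
    refine (norm_sub_le _ _).trans ?_
    linarith [hgσ x, hhσ x]
  have hG'L : eLpNorm G' 2 volume ≤ L := by
    have h1 : eLpNorm G' 2 volume ≤ c⁻¹ • eLpNorm (fun ξ => (w ξ : ℂ) * G ξ) 2 volume := by
      refine eLpNorm_le_nnreal_smul_eLpNorm_of_ae_le_mul (ae_of_all _ fun ξ => ?_) _
      rw [← NNReal.coe_le_coe]
      push_cast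
      refine (norm_indicator_le_norm_self _ _).trans ?_
      rw [norm_mul, Complex.norm_real, Real.norm_of_nonneg (hw.pos ξ).le, ← mul_assoc]
      refine le_mul_of_one_le_left (norm_nonneg _) ?_
      rw [inv_mul_eq_div, one_le_div hc]
      exact hcle ξ
    refine h1.trans ?_
    rw [ENNReal.smul_def, smul_eq_mul, hL, ENNReal.coe_mul]
    gcongr
    exact hG.norm_le
  have hG'0 : ∀ ξ, (R : ℝ) < ‖ξ‖ → G' ξ = 0 := fun ξ hξ =>
    Set.indicator_of_notMem (fun hn : ξ ∈ Eᶜ => hn hξ) _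
  have mulh : ∀ i : ℕ, IsMul v (h ^ i) (σ ^ i) := fun i =>
    ((IsMul.of_inA hv ⟨H, specH⟩).mono hKl).pow i
  have mula : ∀ j : ℕ, IsMul v (a ^ j) (Q * (1 + j * R) ^ N * (2 * σ) ^ j) := by
    intro j
    cases j with
    | zero => simpa using (IsMul.one v).mono (M' := Q) (by rw [hQ]; exact le_self_add)
    | succ j =>
      refine (IsMul.of_inA hv (hv.inA_pow_bandlimited specG' hG'0 hvc hPle hG'L haσ j)).mono ?_
      have h1 : K * P * L / (2 * σ) ≤ Q := by rw [hQ]; exact le_add_self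
      calc K * (P * (1 + (j + 1) * R) ^ N * ((2 * σ) ^ j * L))
          = K * P * L / (2 * σ) * (1 + (j + 1) * R) ^ N * (2 * σ) ^ (j + 1) := by
            rw [pow_succ]; field_simp
        _ ≤ _ := by push_cast; gcongr
  -- The factors `(2σ)^j` and `σ^{m-j}` sum with the binomial coefficients to `(3σ)^m`.
  have hexp : g ^ m = ∑ j ∈ Finset.range (m + 1), ((m.choose j : ℕ) : ℂ) • (a ^ j * h ^ (m - j)) := by
    rw [hgah, add_pow]
    refine Finset.sum_congr rfl fun j _ => ?_
    ext x
    simp only [Pi.mul_apply, Pi.pow_apply, Pi.natCast_apply, Pi.smul_apply, smul_eq_mul]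
    ring
  rw [hexp]
  refine (IsMul.sum hv _ fun j _ => ((mula j).mul (mulh (m - j))).const_smul _).mono ?_
  calc ∑ j ∈ Finset.range (m + 1), ‖((m.choose j : ℕ) : ℂ)‖₊ *
        (Q * (1 + j * R) ^ N * (2 * σ) ^ j * σ ^ (m - j))
      ≤ ∑ j ∈ Finset.range (m + 1), (Q * (1 + m * R) ^ N) *
        ((2 * σ) ^ j * σ ^ (m - j) * (m.choose j : ℝ≥0)) := by
        refine Finset.sum_le_sum fun j hj => ?_
        have hjm : (j : ℝ≥0) ≤ m := by
          exact_mod_cast Nat.lt_succ_iff.1 (Finset.mem_range.1 hj)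
        have hn : ‖((m.choose j : ℕ) : ℂ)‖₊ = (m.choose j : ℝ≥0) := by
          rw [← NNReal.coe_inj]; simp
        rw [hn]
        calc _ = (Q * (1 + j * R) ^ N) * ((2 * σ) ^ j * σ ^ (m - j) * (m.choose j : ℝ≥0)) := by ring
          _ ≤ _ := by gcongr
    _ = Q * σ ^ m * ((1 + m * R) ^ N * 3 ^ m) := by
        rw [← Finset.mul_sum, ← add_pow]
        rw [show 2 * σ + σ = 3 * σ by ring, mul_pow]
        ring
    _ ≤ Q * σ ^ m * (D * 4 ^ m) := mul_le_mul_right (hD m) _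
    _ = _ := by rw [mul_pow]; ring

end WLWeight

end Powers

/-! ### Cauchy's formula and Taylor expansion on polydiscs -/

section Taylor

/-- Induction on the number of factors with the Cauchy product of two absolutely convergent series.
It serves the multivariable geometric series. -/
theorem hasSum_pi_prod {d : ℕ} (f : Fin d → ℕ → ℂ) (s : Fin d → ℂ)
    (hf : ∀ i, Summable fun m => ‖f i m‖) (hs : ∀ i, HasSum (f i) (s i)) :
    (Summable fun α : Fin d → ℕ => ‖∏ i, f i (α i)‖) ∧
      HasSum (fun α : Fin d → ℕ => ∏ i, f i (α i)) (∏ i, s i) := by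
  induction d with
  | zero =>
    exact ⟨(hasSum_unique _).summable, by simp⟩
  | succ d ih =>
    obtain ⟨h1, h2⟩ := ih (fun i => f i.succ) (fun i => s i.succ) (fun i => hf _) fun i => hs _
    have hsum := summable_mul_of_summable_norm (hf 0) h1
    have hnorm := Summable.mul_norm (hf 0) h1
    constructor
    · rw [← (Fin.consEquiv fun _ : Fin (d + 1) => ℕ).summable_iff]
      refine hnorm.congr fun p => ?_
      simp [Fin.consEquiv, Fin.prod_univ_succ]
    · rw [← (Fin.consEquiv fun _ : Fin (d + 1) => ℕ).hasSum_iff, Fin.prod_univ_succ]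
      refine ((hs 0).mul h2 hsum).congr_fun fun p => ?_
      simp [Fin.consEquiv, Fin.prod_univ_succ]

theorem norm_torusMap_sub {d : ℕ} (a : Fin d → ℂ) {ρ : ℝ} (hρ : 0 < ρ) (θ : Fin d → ℝ) (i : Fin d) :
    ‖torusMap a (fun _ => ρ) θ i - a i‖ = ρ := by
  simp [torusMap, Complex.norm_exp_ofReal_mul_I, abs_of_pos hρ]

theorem continuous_torusMap {d : ℕ} (a : Fin d → ℂ) (ρ : ℝ) :
    Continuous (torusMap a fun _ => ρ) := by
  unfold torusMap
  fun_prop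

theorem torusMap_mem_closedBall {d : ℕ} (a : Fin d → ℂ) {ρ : ℝ} (hρ : 0 < ρ) (θ : Fin d → ℝ) :
    torusMap a (fun _ => ρ) θ ∈ Metric.closedBall a ρ := by
  rw [Metric.mem_closedBall, dist_pi_le_iff hρ.le]
  intro i
  rw [dist_eq_norm, norm_torusMap_sub a hρ]

theorem continuous_comp_torusMap {d : ℕ} {Φ : (Fin d → ℂ) → ℂ} {a : Fin d → ℂ} {ρ : ℝ} (hρ : 0 < ρ)
    (hΦ : ContinuousOn Φ (Metric.closedBall a ρ)) :
    Continuous fun θ => Φ (torusMap a (fun _ => ρ) θ) :=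
  hΦ.comp_continuous (continuous_torusMap a ρ) (torusMap_mem_closedBall a hρ)

theorem continuous_prod_torusMap_sub_inv {d : ℕ} {a w : Fin d → ℂ} {ρ : ℝ} (hρ : 0 < ρ)
    (hw : ∀ i, ‖w i - a i‖ < ρ) :
    Continuous fun θ => ∏ i, (torusMap a (fun _ => ρ) θ i - w i)⁻¹ := by
  refine continuous_finsetProd _ fun i _ => Continuous.inv₀ ?_ fun θ h => ?_
  · exact ((continuous_apply i).comp (continuous_torusMap a ρ)).sub continuous_const
  · have h1 := norm_torusMap_sub a hρ θ i
    rw [sub_eq_zero.1 h] at h1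
    exact (hw i).ne h1

/-- Cauchy's integral formula on a polydisc. -/
theorem torusIntegral_prod_sub_inv_smul {d : ℕ} {Φ : (Fin d → ℂ) → ℂ} {a w : Fin d → ℂ} {ρ : ℝ}
    (hρ : 0 < ρ) (hΦ : DifferentiableOn ℂ Φ (Metric.closedBall a ρ)) (hw : ∀ i, ‖w i - a i‖ < ρ) :
    (∯ ζ in T(a, fun _ => ρ), (∏ i, (ζ i - w i)⁻¹) • Φ ζ) =
      (2 * Real.pi * Complex.I) ^ d • Φ w := by
  induction d with
  | zero =>
    rw [torusIntegral_dim0]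
    simp [Subsingleton.elim a w]
  | succ d ih =>
    have hInt : TorusIntegrable (fun ζ => (∏ i, (ζ i - w i)⁻¹) • Φ ζ) a fun _ => ρ := by
      refine Continuous.integrableOn_Icc ?_
      exact (continuous_prod_torusMap_sub_inv hρ hw).smul
        (continuous_comp_torusMap hρ hΦ.continuousOn)
    rw [torusIntegral_succ hInt]
    have mem : ∀ (x : ℂ) (y : Fin d → ℂ), x ∈ Metric.closedBall (a 0) ρ →
        y ∈ Metric.closedBall (a ∘ Fin.succ) ρ → (Fin.cons x y : Fin (d + 1) → ℂ) ∈
          Metric.closedBall a ρ := by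
      intro x y hx hy
      rw [Metric.mem_closedBall, dist_pi_le_iff hρ.le] at hy ⊢
      refine Fin.cases ?_ fun i => ?_
      · simpa using hx
      · simpa using hy i
    have hw' : (fun i => w (Fin.succ i)) ∈ Metric.closedBall (a ∘ Fin.succ) ρ := by
      rw [Metric.mem_closedBall, dist_pi_le_iff hρ.le]
      intro i
      rw [dist_eq_norm]
      exact (hw i.succ).le
    have inner_eq : ∀ x ∈ Metric.closedBall (a 0) ρ,
        (∯ y in T(a ∘ Fin.succ, (fun _ : Fin (d + 1) => ρ) ∘ Fin.succ),
          (∏ i, ((Fin.cons x y : Fin (d + 1) → ℂ) i - w i)⁻¹) • Φ (Fin.cons x y)) =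
        (x - w 0)⁻¹ • ((2 * Real.pi * Complex.I) ^ d • Φ (Fin.cons x fun i => w i.succ)) := by
      intro x hx
      have hd : DifferentiableOn ℂ (fun y : Fin d → ℂ => Φ (Fin.cons x y))
          (Metric.closedBall (a ∘ Fin.succ) ρ) := by
        refine hΦ.comp ?_ fun y hy => mem x y hx hy
        refine Differentiable.differentiableOn (differentiable_pi.2 ?_)
        refine Fin.cases ?_ fun i => ?_
        · simp
        · simpa using differentiable_apply i
      have h := ih (a := a ∘ Fin.succ) (w := fun i => w i.succ) hd fun i => hw i.succ
      rw [← h, ← torusIntegral_smul]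
      have hfun : ((fun _ : Fin (d + 1) => ρ) ∘ Fin.succ) = fun _ : Fin d => ρ := rfl
      rw [hfun]
      congr 1
      ext y
      rw [Fin.prod_univ_succ]
      simp [mul_assoc]
    have hsphere : Metric.sphere (a 0) ρ ⊆ Metric.closedBall (a 0) ρ := Metric.sphere_subset_closedBall
    -- The inner torus integral is known by induction; the outer one is Cauchy's formula in the
    -- first variable.
    rw [circleIntegral.integral_congr hρ.le fun x hx => inner_eq x (hsphere hx)]
    have hd0 : DifferentiableOn ℂ
        (fun x : ℂ => (2 * Real.pi * Complex.I) ^ d • Φ (Fin.cons x fun i => w i.succ))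
        (Metric.closedBall (a 0) ρ) := by
      refine DifferentiableOn.fun_const_smul (R := ℂ) ?_ ((2 * Real.pi * Complex.I) ^ d)
      refine hΦ.comp ?_ fun x hx => mem x _ hx hw'
      refine Differentiable.differentiableOn (differentiable_pi.2 ?_)
      refine Fin.cases ?_ fun i => ?_
      · simp
      · simp
    rw [hd0.circleIntegral_sub_inv_smul (by rw [Metric.mem_ball, dist_eq_norm]; exact hw 0),
      smul_smul, pow_succ']
    congr 2
    exact Fin.cons_self_tail w

/-- Taylor expansion on a polydisc, with Cauchy's estimates. -/
theorem exists_hasSum_taylor {d : ℕ} {Φ : (Fin d → ℂ) → ℂ} {a : Fin d → ℂ} {ρ S : ℝ}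
    (hρ : 0 < ρ) (hΦ : DifferentiableOn ℂ Φ (Metric.closedBall a ρ))
    (hS : ∀ z ∈ Metric.closedBall a ρ, ‖Φ z‖ ≤ S) :
    ∃ c : (Fin d → ℕ) → ℂ, (∀ α, ‖c α‖ ≤ S * ∏ i, ρ⁻¹ ^ α i) ∧
      ∀ z : Fin d → ℂ, (∀ i, ‖z i‖ < ρ) →
        HasSum (fun α => c α * ∏ i, z i ^ α i) (Φ (a + z)) := by
  have hS0 : 0 ≤ S := (norm_nonneg _).trans (hS a (Metric.mem_closedBall_self hρ.le))
  have hpi : ((2 * Real.pi * Complex.I : ℂ) ^ d) ≠ 0 :=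
    pow_ne_zero _ (by simp [Real.pi_ne_zero])
  have hnpi : ‖((2 * Real.pi * Complex.I : ℂ) ^ d)‖ = (2 * Real.pi) ^ d := by
    simp [abs_of_pos Real.pi_pos]
  refine ⟨fun α => ((2 * Real.pi * Complex.I : ℂ) ^ d)⁻¹ *
    ∯ ζ in T(a, fun _ => ρ), (∏ i, ((ζ i - a i) ^ (α i + 1))⁻¹) * Φ ζ, fun α => ?_, fun z hz => ?_⟩
  · have h := norm_torusIntegral_le_of_norm_le_const (c := a) (R := fun _ => ρ)
      (f := fun ζ => (∏ i, ((ζ i - a i) ^ (α i + 1))⁻¹) * Φ ζ)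
      (C := (∏ i : Fin d, (ρ ^ (α i + 1))⁻¹) * S) fun θ => by
        rw [norm_mul, norm_prod]
        simp_rw [norm_inv, norm_pow, norm_torusMap_sub a hρ]
        gcongr
        exact hS _ (torusMap_mem_closedBall a hρ θ)
    rw [norm_mul, norm_inv, hnpi, inv_mul_le_iff₀ (by positivity)]
    refine h.trans (le_of_eq ?_)
    rw [abs_of_pos hρ]
    -- The factor `ρ` per variable from the length of the circle lowers the exponent `α i + 1` to `α
    -- i`.
    have : (∏ i : Fin d, ρ) * ∏ i : Fin d, (ρ ^ (α i + 1))⁻¹ = ∏ i, ρ⁻¹ ^ α i := by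
      rw [← Finset.prod_mul_distrib]
      refine Finset.prod_congr rfl fun i _ => ?_
      rw [pow_succ, inv_pow]
      field_simp
    rw [← this]
    ring
  · have hcauchy := torusIntegral_prod_sub_inv_smul (w := a + z) hρ hΦ (by simpa using hz)
    -- The Cauchy kernel is expanded in geometric series of ratio `z_i / (ζ_i - a_i)`, of modulus
    -- `|z_i| / ρ < 1` on the torus, and integrated termwise by dominated convergence.
    have hmain : HasSum (fun α : Fin d → ℕ => ∯ ζ in T(a, fun _ => ρ),
        (∏ i, ((ζ i - a i) ^ (α i + 1))⁻¹ * z i ^ α i) * Φ ζ)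
        (∯ ζ in T(a, fun _ => ρ), (∏ i, (ζ i - (a + z) i)⁻¹) • Φ ζ) := by
      have hq : ∀ i, ‖z i‖ / ρ < 1 := fun i => (div_lt_one hρ).2 (hz i)
      have hsum : Summable fun α : Fin d → ℕ => ∏ i, (‖z i‖ / ρ) ^ α i := by
        have h := (hasSum_pi_prod (fun i m => ((‖z i‖ / ρ : ℝ) : ℂ) ^ m)
          (fun i => (1 - ((‖z i‖ / ρ : ℝ) : ℂ))⁻¹) (fun i => ?_) fun i => ?_).1
        · refine h.congr fun α => ?_
          rw [norm_prod]
          refine Finset.prod_congr rfl fun i _ => ?_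
          rw [norm_pow, Complex.norm_real, Real.norm_of_nonneg (by positivity)]
        · simp_rw [norm_pow, Complex.norm_real, Real.norm_of_nonneg
            (div_nonneg (norm_nonneg (z i)) hρ.le)]
          exact summable_geometric_of_lt_one (by positivity) (hq i)
        · refine hasSum_geometric_of_norm_lt_one ?_
          rw [Complex.norm_real, Real.norm_of_nonneg (by positivity)]
          exact hq i
      unfold torusIntegral
      refine hasSum_integral_of_dominated_convergence
        (fun α _ => S * ∏ i, (‖z i‖ / ρ) ^ α i) (fun α => ?_) (fun α => ae_of_all _ fun θ => ?_)
        (ae_of_all _ fun θ => hsum.mul_left S) ?_ (ae_of_all _ fun θ => ?_)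
      · refine Continuous.aestronglyMeasurable (Continuous.fun_smul ?_ (Continuous.fun_mul ?_ ?_))
        · fun_prop
        · refine continuous_finsetProd _ fun i _ => Continuous.fun_mul ?_ continuous_const
          refine Continuous.inv₀ ?_ fun θ h => ?_
          · exact (((continuous_apply i).comp (continuous_torusMap a ρ)).sub continuous_const).pow _
          · have h1 := norm_torusMap_sub a hρ θ i
            rw [(pow_eq_zero_iff (Nat.succ_ne_zero _)).1 h, norm_zero] at h1
            exact hρ.ne h1
        · exact continuous_comp_torusMap hρ hΦ.continuousOn
      · rw [norm_smul, norm_mul, norm_prod, norm_prod, ← mul_assoc, ← Finset.prod_mul_distrib,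
          mul_comm]
        refine mul_le_mul (hS _ (torusMap_mem_closedBall a hρ θ)) (le_of_eq ?_) (by positivity) hS0
        refine Finset.prod_congr rfl fun i _ => ?_
        rw [norm_mul, norm_mul, norm_mul, norm_inv, norm_pow, norm_torusMap_sub a hρ,
          Complex.norm_exp_ofReal_mul_I, Complex.norm_I, Complex.norm_real,
          Real.norm_of_nonneg hρ.le, norm_pow, pow_succ, div_pow]
        field_simp
      · exact continuous_const.integrableOn_Icc
      · refine HasSum.const_smul _ ?_
        simp_rw [smul_eq_mul]
        refine HasSum.mul_right _ ?_
        have hne : ∀ i, torusMap a (fun _ => ρ) θ i - a i ≠ 0 := fun i h => by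
          have h1 := norm_torusMap_sub a hρ θ i
          rw [h, norm_zero] at h1
          exact hρ.ne h1
        have hqn : ∀ i, ‖z i / (torusMap a (fun _ => ρ) θ i - a i)‖ < 1 := fun i => by
          rw [norm_div, norm_torusMap_sub a hρ]
          exact hq i
        have hterm : ∀ i (m : ℕ), ((torusMap a (fun _ => ρ) θ i - a i) ^ (m + 1))⁻¹ * z i ^ m =
            (torusMap a (fun _ => ρ) θ i - a i)⁻¹ *
              (z i / (torusMap a (fun _ => ρ) θ i - a i)) ^ m := fun i m => by
          have := hne i
          rw [div_pow, pow_succ]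
          field_simp
        refine (hasSum_pi_prod (fun i m => ((torusMap a (fun _ => ρ) θ i - a i) ^ (m + 1))⁻¹ *
          z i ^ m) _ (fun i => ?_) fun i => ?_).2
        · simp_rw [hterm, norm_mul, norm_pow]
          exact (summable_geometric_of_lt_one (norm_nonneg _) (hqn i)).mul_left _
        · simp_rw [hterm]
          have h := (hasSum_geometric_of_norm_lt_one (hqn i)).mul_left
            (torusMap a (fun _ => ρ) θ i - a i)⁻¹
          have e : (torusMap a (fun _ => ρ) θ i - a i)⁻¹ *
              (1 - z i / (torusMap a (fun _ => ρ) θ i - a i))⁻¹ =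
              (torusMap a (fun _ => ρ) θ i - (a + z) i)⁻¹ := by
            rw [← mul_inv, mul_sub, mul_one, mul_div_cancel₀ _ (hne i), Pi.add_apply, sub_sub]
          rw [e] at h
          exact h
    rw [hcauchy] at hmain
    have h2 := hmain.mul_left ((2 * Real.pi * Complex.I : ℂ) ^ d)⁻¹
    rw [smul_eq_mul, inv_mul_cancel_left₀ hpi] at h2
    refine h2.congr_fun fun α => ?_
    rw [mul_assoc, mul_comm _ (∏ i, z i ^ α i), ← torusIntegral_const_mul]
    congr 2
    ext ζ
    rw [Finset.prod_mul_distrib]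
    ring

end Taylor

/-! ### Cutoffs, equicontinuity and comparison of weights -/

section Local

open Filter Topology

theorem exists_bump {V : Type*} [NormedAddCommGroup V] [InnerProductSpace ℝ V]
    [FiniteDimensional ℝ V] {t : ℝ} (ht : 0 < t) :
    ∃ χ : V → ℂ, ContDiff ℝ ∞ χ ∧ HasCompactSupport χ ∧ tsupport χ ⊆ Metric.ball 0 t ∧
      (∀ x, ‖x‖ ≤ t / 4 → χ x = 1) ∧ ∀ x, ‖χ x‖ ≤ 1 := by
  let B : ContDiffBump (0 : V) := ⟨t / 4, t / 2, by positivity, by linarith⟩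
  have hsupp : Function.support (fun x => (B x : ℂ)) = Function.support B := by
    ext x
    simp
  refine ⟨fun x => (B x : ℂ), Complex.ofRealCLM.contDiff.comp B.contDiff, ?_, ?_, fun x hx => ?_,
    fun x => ?_⟩
  · exact B.hasCompactSupport.comp_left (g := fun t : ℝ => (t : ℂ)) rfl
  · have : tsupport (fun x => (B x : ℂ)) = tsupport B := by
      rw [tsupport, tsupport, hsupp]
    rw [this, B.tsupport_eq]
    exact Metric.closedBall_subset_ball (by simp only [B]; linarith)
  · have : x ∈ Metric.closedBall (0 : V) B.rIn := by simpa [B] using hx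
    simp only [B.one_of_mem_closedBall this, Complex.ofReal_one]
  · rw [Complex.norm_real, Real.norm_of_nonneg B.nonneg]
    exact B.le_one

variable {V : Type*} [NormedAddCommGroup V] [InnerProductSpace ℝ V] [FiniteDimensional ℝ V]
  [MeasurableSpace V] [BorelSpace V]

/-- Smooth compactly supported functions belong to the algebra of a weight of polynomial growth. -/
theorem exists_inA_of_contDiff {v : V → ℝ} {P : ℝ} {N : ℕ} (hm : Measurable v)
    (hv : ∀ ξ, 0 ≤ v ξ) (hP : ∀ ξ, v ξ ≤ P * (1 + ‖ξ‖) ^ N) {θ : V → ℂ} (hθ : ContDiff ℝ ∞ θ)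
    (hθc : HasCompactSupport θ) : ∃ M : ℝ≥0, InA v θ M := by
  let φ : 𝓢(V, ℂ) := hθc.toSchwartzMap hθ
  have hφ : (φ : V → ℂ) = θ := rfl
  have hP0 : 0 ≤ P := by simpa using (hv 0).trans (hP 0)
  have hg : (fun ξ : V => ((1 : ℝ) + ‖ξ‖ ^ 2) ^ N).HasTemperateGrowth :=
    ((Function.HasTemperateGrowth.const (1 : ℝ)).add (Function.hasTemperateGrowth_norm_sq V)).pow N
  have hL : MemLp (fun ξ => ((1 : ℝ) + ‖ξ‖ ^ 2) ^ N • (𝓕 φ) ξ) 2 volume := by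
    have := (SchwartzMap.smulLeftCLM ℂ (fun ξ : V => ((1 : ℝ) + ‖ξ‖ ^ 2) ^ N) (𝓕 φ)).memLp 2
    rwa [SchwartzMap.smulLeftCLM_apply hg] at this
  have hmeas : AEStronglyMeasurable (fun ξ => (v ξ : ℂ) * (𝓕 φ) ξ) volume :=
    ((Complex.measurable_ofReal.comp hm).aestronglyMeasurable).mul
      (𝓕 φ).continuous.aestronglyMeasurable
  have hMem : MemLp (fun ξ => (v ξ : ℂ) * (𝓕 φ) ξ) 2 volume := by
    refine hL.of_le_mul (c := P * 2 ^ N) hmeas (ae_of_all _ fun ξ => ?_)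
    rw [norm_mul, norm_smul, Complex.norm_real, Real.norm_of_nonneg (hv ξ),
      Real.norm_of_nonneg (by positivity), ← mul_assoc]
    gcongr
    refine (hP ξ).trans ?_
    rw [mul_assoc, ← mul_pow]
    gcongr
    nlinarith [sq_nonneg (‖ξ‖ - 1), norm_nonneg ξ]
  refine ⟨(eLpNorm (fun ξ => (v ξ : ℂ) * (𝓕 φ) ξ) 2 volume).toNNReal, (𝓕 φ : 𝓢(V, ℂ)),
    (𝓕 φ).continuous.aestronglyMeasurable, ?_, ?_⟩
  · rw [ENNReal.coe_toNNReal hMem.2.ne]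
  · rw [← SchwartzMap.fourierInv_coe, FourierTransform.fourierInv_fourier_eq]
    exact hφ.symm

/-- Balls of the algebra are uniformly equicontinuous. -/
theorem AlgWeight.equicontinuous {v : V → ℝ} {C : ℝ≥0} (hv : AlgWeight v C) (M : ℝ≥0) {ε : ℝ}
    (hε : 0 < ε) : ∃ r : ℝ, 0 < r ∧ ∀ g : V → ℂ, InA v g M → ∀ x y, ‖x - y‖ < r →
      ‖g x - g y‖ ≤ ε := by
  -- By Cauchy–Schwarz, `|g(x) - g(y)|² ≤ J(x - y) M²`. `J` tends to `0` at the origin by dominated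
  -- convergence, as `v⁻¹ ∈ L²`.
  let J : V → ℝ≥0∞ := fun h => ∫⁻ ξ, (‖(Real.fourierChar (inner ℝ ξ h) : ℂ) - 1‖ₑ *
    ‖(v ξ : ℂ)⁻¹‖ₑ) ^ 2
  have hvm : Measurable fun ξ => (v ξ : ℂ)⁻¹ := (Complex.measurable_ofReal.comp hv.meas).inv
  have hcont : Continuous fun p : V × V => ((Real.fourierChar (inner ℝ p.1 p.2) : Circle) : ℂ) :=
    continuous_subtype_val.comp (Real.continuous_fourierChar.comp (by fun_prop))
  have hcm : ∀ h : V, Measurable fun ξ : V =>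
      ‖((Real.fourierChar (inner ℝ ξ h) : Circle) : ℂ) - 1‖ₑ := fun h =>
    ((hcont.comp (continuous_id.prodMk continuous_const)).sub continuous_const).measurable.enorm
  have hJ : Tendsto J (𝓝 0) (𝓝 0) := by
    have h := tendsto_lintegral_filter_of_dominated_convergence (μ := (volume : Measure V))
      (l := 𝓝 (0 : V))
      (F := fun h ξ => (‖((Real.fourierChar (inner ℝ ξ h) : Circle) : ℂ) - 1‖ₑ *
        ‖(v ξ : ℂ)⁻¹‖ₑ) ^ 2) (f := fun _ => 0) (fun ξ => (2 * ‖(v ξ : ℂ)⁻¹‖ₑ) ^ 2)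
      (Eventually.of_forall fun h => ((hcm h).mul hvm.enorm).pow_const 2)
      (Eventually.of_forall fun h => ae_of_all _ fun ξ => ?_) ?_ (ae_of_all _ fun ξ => ?_)
    · simpa using h
    · gcongr
      rw [← ofReal_norm]
      refine ENNReal.ofReal_le_of_le_toReal ?_
      refine (norm_sub_le _ _).trans ?_
      rw [Circle.norm_coe, norm_one]
      norm_num
    · simp_rw [mul_pow]
      rw [lintegral_const_mul' _ _ (by simp), ← eLpNorm_two_sq]
      exact ENNReal.mul_ne_top (by simp)
        (ENNReal.pow_ne_top (hv.inv_norm_le.trans_lt ENNReal.coe_lt_top).ne)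
    · have hc : Continuous fun h : V =>
          ‖((Real.fourierChar (inner ℝ ξ h) : Circle) : ℂ) - 1‖ₑ :=
        ((hcont.comp (continuous_const.prodMk continuous_id)).sub continuous_const).enorm
      have h0 : Tendsto (fun h : V => ‖((Real.fourierChar (inner ℝ ξ h) : Circle) : ℂ) - 1‖ₑ)
          (𝓝 0) (𝓝 0) := by
        have := hc.tendsto 0
        simpa using this
      have h1 := ENNReal.Tendsto.pow (n := 2)
        (ENNReal.Tendsto.mul_const (b := ‖(v ξ : ℂ)⁻¹‖ₑ) h0 (Or.inr enorm_ne_top))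
      simpa using h1
  have hε' : 0 < ENNReal.ofReal (ε ^ 2 / (M + 1) ^ 2) := by
    rw [ENNReal.ofReal_pos]
    positivity
  obtain ⟨r, hr, hball⟩ := Metric.eventually_nhds_iff.1 (hJ.eventually (gt_mem_nhds hε'))
  refine ⟨r, hr, fun g hg x y hxy => ?_⟩
  obtain ⟨G, hG⟩ := hg
  have hJr : J (x - y) < ENNReal.ofReal (ε ^ 2 / (M + 1) ^ 2) := hball (by simpa using hxy)
  have hconv : ∀ z : V, Integrable (fun ξ => Real.fourierChar (inner ℝ ξ z) • G ξ) volume :=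
    fun z => by simpa using (Real.fourierIntegral_convergent_iff (-z)).2 (hv.integrable hG)
  have hdiff : g x - g y = ∫ ξ, ((Real.fourierChar (inner ℝ ξ x) : ℂ) -
      (Real.fourierChar (inner ℝ ξ y) : ℂ)) * G ξ := by
    rw [hG.eq, Real.fourierInv_eq, Real.fourierInv_eq, ← integral_sub (hconv x) (hconv y)]
    refine integral_congr_ae (ae_of_all _ fun ξ => ?_)
    simp only [Circle.smul_def, smul_eq_mul]
    ring
  have hle : ‖g x - g y‖ₑ ≤ ∫⁻ ξ, (‖((Real.fourierChar (inner ℝ ξ (x - y)) : Circle) : ℂ) - 1‖ₑ *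
      ‖(v ξ : ℂ)⁻¹‖ₑ) * ‖(v ξ : ℂ) * G ξ‖ₑ := by
    rw [hdiff]
    refine (enorm_integral_le_lintegral_enorm _).trans (lintegral_mono fun ξ => le_of_eq ?_)
    have hne : (v ξ : ℂ) ≠ 0 := by exact_mod_cast (hv.pos ξ).ne'
    have e1 : ((Real.fourierChar (inner ℝ ξ x) : Circle) : ℂ) =
        (Real.fourierChar (inner ℝ ξ (x - y)) : ℂ) * (Real.fourierChar (inner ℝ ξ y) : ℂ) := by
      rw [← Circle.coe_mul, ← AddChar.map_add_eq_mul, ← inner_add_right, sub_add_cancel]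
    have e2 : (((Real.fourierChar (inner ℝ ξ x) : Circle) : ℂ) -
        (Real.fourierChar (inner ℝ ξ y) : ℂ)) * G ξ = (Real.fourierChar (inner ℝ ξ y) : ℂ) *
        ((((Real.fourierChar (inner ℝ ξ (x - y)) : Circle) : ℂ) - 1) * (v ξ : ℂ)⁻¹ *
          ((v ξ : ℂ) * G ξ)) := by
      rw [e1]
      field_simp
    have e3 : ‖((Real.fourierChar (inner ℝ ξ y) : Circle) : ℂ)‖ₑ = 1 := by
      rw [← ofReal_norm, Circle.norm_coe, ENNReal.ofReal_one]
    rw [e2, enorm_mul, e3, one_mul, enorm_mul, enorm_mul]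
  have hm1 : AEMeasurable (fun ξ => ‖((Real.fourierChar (inner ℝ ξ (x - y)) : Circle) : ℂ) - 1‖ₑ *
      ‖(v ξ : ℂ)⁻¹‖ₑ) volume := ((hcm _).mul hvm.enorm).aemeasurable
  have hm2 : AEMeasurable (fun ξ => ‖(v ξ : ℂ) * G ξ‖ₑ) volume :=
    ((Complex.measurable_ofReal.comp hv.meas).aestronglyMeasurable.mul hG.meas).enorm
  have hsq : ‖g x - g y‖ₑ ^ 2 ≤ ENNReal.ofReal (ε ^ 2 / (M + 1) ^ 2) * (M : ℝ≥0∞) ^ 2 := by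
    calc _ ≤ _ := pow_le_pow_left' hle 2
      _ ≤ _ := lintegral_mul_sq_le hm1 hm2
      _ ≤ _ := mul_le_mul' hJr.le ((eLpNorm_two_le_iff _ _).1 hG.norm_le)
  have hsq' : ‖g x - g y‖ ^ 2 ≤ ε ^ 2 := by
    rw [← ofReal_norm, ← ENNReal.ofReal_pow (norm_nonneg _), ← ENNReal.ofReal_coe_nnreal,
      ← ENNReal.ofReal_pow M.coe_nonneg, ← ENNReal.ofReal_mul (by positivity),
      ENNReal.ofReal_le_ofReal_iff (by positivity)] at hsq
    refine hsq.trans ?_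
    rw [div_mul_eq_mul_div, div_le_iff₀ (by positivity)]
    gcongr
    linarith
  exact le_of_sq_le_sq hsq' hε.le

/-- A weight that is comparable to an algebra weight is an algebra weight. -/
theorem AlgWeight.of_le_of_le {v w : V → ℝ} {C c : ℝ≥0} (hv : AlgWeight v C) (hm : Measurable w)
    (hp : ∀ ξ, 0 < w ξ) (hc : 1 ≤ c) (h1 : ∀ ξ, w ξ ≤ v ξ) (h2 : ∀ ξ, v ξ ≤ c * w ξ) :
    AlgWeight w (c ^ 2 * C) := by
  have hcp : (0 : ℝ) < c := lt_of_lt_of_le one_pos (by exact_mod_cast hc)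
  refine ⟨hm, hp, ?_, fun ξ => ?_⟩
  · have h : eLpNorm (fun ξ => (w ξ : ℂ)⁻¹) 2 volume ≤
        c • eLpNorm (fun ξ => (v ξ : ℂ)⁻¹) 2 volume := by
      refine eLpNorm_le_nnreal_smul_eLpNorm_of_ae_le_mul (ae_of_all _ fun ξ => ?_) _
      rw [← NNReal.coe_le_coe]
      push_cast
      rw [norm_inv, norm_inv, Complex.norm_real, Complex.norm_real, Real.norm_of_nonneg (hp ξ).le,
        Real.norm_of_nonneg (hv.pos ξ).le, ← div_eq_mul_inv, inv_le_comm₀ (hp ξ)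
        (div_pos hcp (hv.pos ξ)), inv_div, div_le_iff₀ hcp, mul_comm]
      exact h2 ξ
    refine h.trans ?_
    rw [ENNReal.smul_def, smul_eq_mul]
    refine (mul_le_mul_right hv.inv_norm_le _).trans ?_
    rw [← ENNReal.coe_mul]
    gcongr
    exact le_self_pow₀ hc two_ne_zero
  · have hinv : ∀ η, 1 / w η ^ 2 ≤ c ^ 2 * (1 / v η ^ 2) := fun η => by
      have := hp η
      have := hv.pos η
      rw [mul_one_div, div_le_div_iff₀ (by positivity) (by positivity), one_mul, ← mul_pow]
      gcongr
      exact h2 η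
    calc _ ≤ ∫⁻ η, ENNReal.ofReal ((c ^ 2) ^ 2) *
          (ENNReal.ofReal (1 / v η ^ 2) * ENNReal.ofReal (1 / v (ξ - η) ^ 2)) := by
          refine lintegral_mono fun η => ?_
          dsimp only
          have := hv.pos η
          have := hv.pos (ξ - η)
          have hc0 : (0 : ℝ) ≤ (c : ℝ) ^ 2 := by positivity
          rw [sq ((c : ℝ) ^ 2), ENNReal.ofReal_mul hc0, mul_mul_mul_comm,
            ← ENNReal.ofReal_mul hc0, ← ENNReal.ofReal_mul hc0]
          exact mul_le_mul' (ENNReal.ofReal_le_ofReal (hinv _)) (ENNReal.ofReal_le_ofReal (hinv _))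
      _ = ENNReal.ofReal ((c ^ 2) ^ 2) * ∫⁻ η,
          (ENNReal.ofReal (1 / v η ^ 2) * ENNReal.ofReal (1 / v (ξ - η) ^ 2)) := by
          rw [lintegral_const_mul' _ _ ENNReal.ofReal_ne_top]
      _ ≤ ENNReal.ofReal ((c ^ 2) ^ 2) * ENNReal.ofReal (C ^ 2 / v ξ ^ 2) := by
          gcongr
          exact hv.conv_le ξ
      _ ≤ _ := by
          rw [← ENNReal.ofReal_mul (by positivity)]
          refine ENNReal.ofReal_le_ofReal ?_
          push_cast
          rw [mul_pow, mul_div_assoc]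
          have := hp ξ
          gcongr
          exact h1 ξ

/-- The weight `w^δ + w`, the case `l = 1`, is comparable to `w` because `w^δ ≤ B w`. -/
theorem WLWeight.exists_algWeight {w b : V → ℝ} {δ A C : ℝ} {N : ℕ} (hw : WLWeight w b δ A C N) :
    ∃ K : ℝ≥0, AlgWeight w K := by
  obtain ⟨K, -, hK⟩ := hw.algWeight
  obtain ⟨B, hB, hBle⟩ := hw.exists_rpow_le_all
  lift B to ℝ≥0 using hB.le
  refine ⟨_, (hK 1 one_pos).of_le_of_le (c := B + 1) hw.meas hw.pos le_add_self (fun ξ => ?_)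
    fun ξ => ?_⟩
  · have : 0 < w ξ ^ δ := Real.rpow_pos_of_pos (hw.pos ξ) δ
    simp only [one_mul]
    linarith
  · push_cast
    have := hBle ξ
    linarith

end Local

/-! ### The local Wiener–Lévy theorem, uniform in translations -/

section WienerLevy

open Filter Topology

variable {V : Type*} [NormedAddCommGroup V] [InnerProductSpace ℝ V] [FiniteDimensional ℝ V]
  [MeasurableSpace V] [BorelSpace V]

/-- `f` belongs to the algebra of `w` locally, uniformly with respect to translations, when
multiplied by cutoffs with small support. -/
def UnifLocA (w : V → ℝ) (f : V → ℂ) : Prop :=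
  ∃ r : ℝ, 0 < r ∧ ∀ θ : V → ℂ, ContDiff ℝ ∞ θ → HasCompactSupport θ →
    tsupport θ ⊆ Metric.ball 0 r → ∃ M : ℝ≥0, ∀ z, InA w (fun x => θ (x - z) * f x) M

theorem exists_pos_forall_of_fin {d : ℕ} {p : Fin d → ℝ → Prop}
    (hp : ∀ j, ∃ r : ℝ, 0 < r ∧ ∀ s, 0 < s → s ≤ r → p j s) : ∃ r : ℝ, 0 < r ∧ ∀ j, p j r := by
  have h : ∀ᶠ r in 𝓝[>] (0 : ℝ), ∀ j, p j r := by
    rw [eventually_all]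
    intro j
    obtain ⟨r, hr, h⟩ := hp j
    filter_upwards [Ioc_mem_nhdsGT hr] with s hs using h s hs.1 hs.2
  obtain ⟨r, h1, h2⟩ := (h.and self_mem_nhdsWithin).exists
  exact ⟨r, h2, h1⟩

namespace UnifLocA

variable {w : V → ℝ} {K : ℝ≥0} {f : V → ℂ}

/-- A bump equal to `1` at the origin, centred at the point `x` itself, reduces this to the sup
bound in the algebra. -/
theorem exists_norm_le (hw : AlgWeight w K) (hf : UnifLocA w f) : ∃ B : ℝ≥0, ∀ x, ‖f x‖ ≤ B := by
  obtain ⟨r, hr, h⟩ := hf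
  obtain ⟨χ, h1, h2, h3, h4, -⟩ := exists_bump (V := V) hr
  obtain ⟨M, hM⟩ := h χ h1 h2 h3
  refine ⟨K * M, fun x => ?_⟩
  have := (hM x).norm_apply_le hw x
  rw [sub_self, h4 0 (by simp; positivity), one_mul] at this
  exact_mod_cast this

theorem uniformContinuous (hw : AlgWeight w K) (hf : UnifLocA w f) {ε : ℝ} (hε : 0 < ε) :
    ∃ s : ℝ, 0 < s ∧ ∀ x z, ‖x - z‖ < s → ‖f x - f z‖ ≤ ε := by
  obtain ⟨r, hr, h⟩ := hf
  obtain ⟨χ, h1, h2, h3, h4, -⟩ := exists_bump (V := V) hr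
  obtain ⟨M, hM⟩ := h χ h1 h2 h3
  obtain ⟨s, hs, hs'⟩ := hw.equicontinuous M hε
  refine ⟨min s (r / 4), by positivity, fun x z hxz => ?_⟩
  have := hs' _ (hM z) x z (hxz.trans_le (min_le_left _ _))
  rwa [h4 (x - z) (hxz.le.trans (min_le_right _ _)), sub_self, h4 0 (by simp; positivity), one_mul,
    one_mul] at this

theorem isBounded_range {d : ℕ} {f : V → Fin d → ℂ} (hw : AlgWeight w K)
    (hf : ∀ j, UnifLocA w fun x => f x j) : Bornology.IsBounded (Set.range f) := by
  choose B hB using fun j => (hf j).exists_norm_le hw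
  refine (Metric.isBounded_closedBall (x := 0) (r := ∑ j, (B j : ℝ))).subset ?_
  rintro _ ⟨x, rfl⟩
  rw [mem_closedBall_zero_iff, pi_norm_le_iff_of_nonneg (by positivity)]
  intro j
  refine (hB j x).trans ?_
  exact Finset.single_le_sum (f := fun j => (B j : ℝ)) (fun i _ => (B i).coe_nonneg)
    (Finset.mem_univ j)

end UnifLocA

/-- The local form of the Wiener–Lévy theorem, with bounds uniform with respect to translations. -/
theorem WLWeight.wienerLevy {w b : V → ℝ} {δ A C : ℝ} {N d : ℕ} (hw : WLWeight w b δ A C N)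
    {f : V → Fin d → ℂ} (hf : ∀ j, UnifLocA w fun x => f x j) {Ω : Set (Fin d → ℂ)}
    (hΩ : IsOpen Ω) {Φ : (Fin d → ℂ) → ℂ} (hΦ : DifferentiableOn ℂ Φ Ω)
    (hfΩ : closure (Set.range f) ⊆ Ω) :
    ∃ ψ : V → ℂ, ContDiff ℝ ∞ ψ ∧ HasCompactSupport ψ ∧ ψ 0 ≠ 0 ∧
      ∃ M : ℝ≥0, ∀ z, InA w (fun x => ψ (x - z) * Φ (f x)) M := by
  obtain ⟨K, hK⟩ := hw.exists_algWeight
  choose B hB using fun j => (hf j).exists_norm_le hK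
  have hcomp : IsCompact (closure (Set.range f)) :=
    (UnifLocA.isBounded_range hK hf).isCompact_closure
  -- Compactness gives one radius for all centres `f z`. In the sup norm of `Fin d → ℂ` the closed
  -- balls are polydiscs.
  obtain ⟨ρ, hρ, hρΩ⟩ := hcomp.exists_cthickening_subset_open hΩ hfΩ
  have hsub : ∀ z, Metric.closedBall (f z) ρ ⊆ Metric.cthickening ρ (closure (Set.range f)) :=
    fun z => Metric.closedBall_subset_cthickening (subset_closure (Set.mem_range_self z)) ρ
  obtain ⟨S, hS⟩ := (hcomp.cthickening (r := ρ)).exists_bound_of_continuousOn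
    (hΦ.continuousOn.mono hρΩ)
  lift ρ to ℝ≥0 using hρ.le
  have hρ' : 0 < ρ := by exact_mod_cast hρ
  -- Powers grow like `(4σ)^m` and Taylor coefficients like `ρ^{-|α|}`, so `4σ/ρ = 1/2` makes the
  -- series geometric.
  set σ : ℝ≥0 := ρ / 8 with hσ
  have hσpos : 0 < σ := by positivity
  obtain ⟨t, ht, hloc⟩ : ∃ t : ℝ, 0 < t ∧ ∀ j,
      (∀ θ : V → ℂ, ContDiff ℝ ∞ θ → HasCompactSupport θ → tsupport θ ⊆ Metric.ball 0 t →
        ∃ M : ℝ≥0, ∀ z, InA w (fun x => θ (x - z) * f x j) M) ∧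
      ∀ x z, ‖x - z‖ < t → ‖f x j - f z j‖ ≤ σ := by
    refine exists_pos_forall_of_fin fun j => ?_
    obtain ⟨s, hs, hs'⟩ := (hf j).uniformContinuous hK (ε := σ) (by exact_mod_cast hσpos)
    obtain ⟨r, hr, hr'⟩ := hf j
    refine ⟨min r s, by positivity, fun t ht htle => ⟨fun θ h1 h2 h3 => hr' θ h1 h2 (h3.trans ?_),
      fun x z hxz => hs' x z (hxz.trans_le (htle.trans (min_le_right _ _)))⟩⟩
    exact Metric.ball_subset_ball (htle.trans (min_le_left _ _))
  obtain ⟨χ, χ1, χ2, χ3, χ4, χ5⟩ := exists_bump (V := V) ht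
  -- The support of `ψ` lies where `χ = 1`, so on it `f z + g z` equals `f`.
  obtain ⟨ψ, ψ1, ψ2, ψ3, ψ4, -⟩ := exists_bump (V := V) (t := t / 4) (by positivity)
  have hgrow : ∀ ξ, w ξ ≤ A * w 0 * (1 + ‖ξ‖) ^ N := fun ξ => by
    have := hw.growth ξ 0
    rw [add_zero] at this
    linarith
  obtain ⟨Mχ, hMχ⟩ := exists_inA_of_contDiff hw.meas (fun ξ => (hw.pos ξ).le) hgrow χ1 χ2
  obtain ⟨Mψ, hMψ⟩ := exists_inA_of_contDiff hw.meas (fun ξ => (hw.pos ξ).le) hgrow ψ1 ψ2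
  choose M₁ hM₁ using fun j => (hloc j).1 χ χ1 χ2 χ3
  set M : ℝ≥0 := ∑ j, (M₁ j + B j * Mχ) with hM
  let g : V → Fin d → V → ℂ := fun z j x => χ (x - z) * (f x j - f z j)
  have hg : ∀ z j, InA w (g z j) M := by
    intro z j
    have h1 := (hM₁ j z).add hK ((hMχ.comp_sub z).const_smul (-f z j))
    have e : g z j = (fun x => χ (x - z) * f x j) + -f z j • fun x => χ (x - z) := by
      ext x
      simp only [g, Pi.add_apply, Pi.smul_apply, smul_eq_mul]
      ring
    rw [e]
    refine h1.mono ?_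
    rw [hM]
    refine le_trans ?_ (Finset.single_le_sum (f := fun j => M₁ j + B j * Mχ)
      (fun _ _ => zero_le) (Finset.mem_univ j))
    gcongr
    rw [nnnorm_neg]
    exact_mod_cast hB j z
  have hgσ : ∀ z j x, ‖g z j x‖ ≤ σ := by
    intro z j x
    simp only [g, norm_mul]
    by_cases hx : ‖x - z‖ < t
    · exact (mul_le_of_le_one_left (norm_nonneg _) (χ5 _)).trans ((hloc j).2 x z hx)
    · have h0 : χ (x - z) = 0 := by
        refine image_eq_zero_of_notMem_tsupport fun h => hx ?_
        simpa using χ3 h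
      simp [h0]
  -- `M` and `σ` serve all `z` and `j`, so `l` and `D` do too; this gives uniformity in
  -- translations.
  obtain ⟨l, hl, D, hD⟩ := hw.exists_isMul_pow hσpos M
  obtain ⟨K', -, hAlg⟩ := hw.algWeight
  obtain ⟨B', hB', hBle⟩ := hw.exists_rpow_le_all
  lift B' to ℝ≥0 using hB'.le
  lift l to ℝ≥0 using hl.le
  set v : V → ℝ := fun ξ => w ξ ^ δ + l * w ξ with hv
  have hvA : AlgWeight v K' := hAlg l hl
  have hψv : InA v ψ ((B' + l) * Mψ) := hMψ.of_weight_le (fun ξ => (hvA.pos ξ).le) fun ξ => by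
    push_cast
    rw [add_mul]
    exact add_le_add (hBle ξ) le_rfl
  set Kψ : ℝ≥0 := (B' + l) * Mψ with hKψ
  set S' : ℝ≥0 := Real.toNNReal S with hS'
  let κ : (Fin d → ℕ) → ℝ≥0 := fun α => S' * Kψ * D ^ d * ∏ i, (1 / 2) ^ α i
  have hκ : Summable κ := by
    have h := (hasSum_pi_prod (fun (_ : Fin d) m => (1 / 2 : ℂ) ^ m) (fun _ => (1 - 1 / 2)⁻¹)
      (fun i => ?_) fun i => hasSum_geometric_of_norm_lt_one (by norm_num)).1
    · refine Summable.mul_left _ ?_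
      rw [← NNReal.summable_coe]
      refine h.congr fun α => ?_
      push_cast
      rw [norm_prod]
      simp
    · simp_rw [norm_pow]
      exact summable_geometric_of_lt_one (norm_nonneg _) (by norm_num)
  refine ⟨ψ, ψ1, ψ2, by rw [ψ4 0 (by simp; positivity)]; exact one_ne_zero,
    l⁻¹ * ∑' α, κ α, fun z => ?_⟩
  have hvfin : InA v (fun x => ψ (x - z) * Φ (f x)) (∑' α, κ α) := by
    obtain ⟨c, hc, hsum⟩ := exists_hasSum_taylor (a := f z) hρ (hΦ.mono ((hsub z).trans hρΩ))
      fun ζ hζ => hS ζ (hsub z hζ)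
    have hS0 : 0 ≤ S := (norm_nonneg _).trans (hS (f z) (hsub z (Metric.mem_closedBall_self hρ.le)))
    refine InA.hasSum hvA (F := fun α => c α • ((fun x => ψ (x - z)) * ∏ j, g z j ^ α j))
      (fun α => ?_) hκ fun x => ?_
    · have h1 := (IsMul.prod Finset.univ fun j _ => hD (g z j) (hg z j) (hgσ z j) (α j)) _ _
        (hψv.comp_sub z)
      refine (h1.const_smul (c α)).mono ?_
      have hcα : ‖c α‖₊ ≤ S' * ∏ i, ρ⁻¹ ^ α i := by
        rw [← NNReal.coe_le_coe]
        push_cast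
        rw [hS', Real.coe_toNNReal _ hS0]
        exact hc α
      refine (mul_le_mul_left hcα _).trans (le_of_eq ?_)
      simp only [κ]
      rw [Finset.prod_mul_distrib, Finset.prod_const, Finset.card_univ, Fintype.card_fin]
      have : (∏ i, ρ⁻¹ ^ α i) * ∏ i, (4 * σ) ^ α i = ∏ i, (1 / 2 : ℝ≥0) ^ α i := by
        rw [← Finset.prod_mul_distrib]
        refine Finset.prod_congr rfl fun i _ => ?_
        rw [← mul_pow]
        congr 1
        rw [hσ]
        field_simp
        norm_num
      rw [← this]
      ring
    -- Off the support of `ψ` both sides vanish, so the Taylor expansion is only needed where `χ =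
    -- 1`.
    · by_cases hx : ψ (x - z) = 0
      · simp [hx]
      · have hxz : ‖x - z‖ < t / 4 := by
          by_contra hcon
          refine hx (image_eq_zero_of_notMem_tsupport fun h => hcon ?_)
          simpa using ψ3 h
        have hχ : χ (x - z) = 1 := χ4 _ hxz.le
        have hfx : f z + (fun j => g z j x) = f x := by
          ext j
          simp [g, hχ]
        have h1 := hsum (fun j => g z j x) fun j => (hgσ z j x).trans_lt (by
          rw [NNReal.coe_lt_coe, hσ]
          exact div_lt_self hρ' (by norm_num))
        rw [hfx] at h1
        refine (h1.mul_left (ψ (x - z))).congr_fun fun α => ?_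
        simp only [Pi.smul_apply, Pi.mul_apply, Finset.prod_apply, Pi.pow_apply, smul_eq_mul]
        ring
  -- Return to the original weight through `l w ≤ v`.
  refine hvfin.of_weight_le (fun ξ => (hw.pos ξ).le) fun ξ => ?_
  have h1 : 0 < w ξ ^ δ := Real.rpow_pos_of_pos (hw.pos ξ) δ
  push_cast
  rw [← div_eq_inv_mul, le_div_iff₀ hl]
  simp only [hv]
  linarith

end WienerLevy

/-! ### Change of Fourier normalization: dilation by `2π` -/

section Scaling

variable {n : ℕ}

/-- The Jacobian of the dilation by `2π`. -/
noncomputable def dilFactor (n : ℕ) : ℝ≥0 := Real.toNNReal ((2 * Real.pi) ^ n)⁻¹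

theorem map_dilation :
    (volume : Measure (Rn n)).map (fun ξ => (2 * Real.pi) • ξ) = (dilFactor n : ℝ≥0∞) • volume := by
  have h := Measure.map_addHaar_smul (volume : Measure (Rn n)) (r := 2 * Real.pi)
    Real.two_pi_pos.ne'
  rw [finrank_euclideanSpace_fin, abs_of_pos (by positivity)] at h
  exact h

theorem measurableEmbedding_dilation :
    MeasurableEmbedding fun ξ : Rn n => (2 * Real.pi) • ξ :=
  (Homeomorph.smulOfNeZero (2 * Real.pi) Real.two_pi_pos.ne').measurableEmbedding

theorem lintegral_dilation (f : Rn n → ℝ≥0∞) :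
    ∫⁻ ξ, f ((2 * Real.pi) • ξ) = dilFactor n * ∫⁻ ξ, f ξ := by
  rw [← measurableEmbedding_dilation.lintegral_map, map_dilation, lintegral_smul_measure,
    smul_eq_mul]

theorem quasiMeasurePreserving_dilation :
    Measure.QuasiMeasurePreserving (fun ξ : Rn n => (2 * Real.pi) • ξ) volume volume := by
  refine ⟨measurableEmbedding_dilation.measurable, ?_⟩
  rw [map_dilation]
  exact Measure.smul_absolutelyContinuous

theorem dilFactor_pos : 0 < dilFactor n := Real.toNNReal_pos.2 (by positivity)

theorem eLpNorm_dilation (F : Rn n → ℂ) :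
    eLpNorm (fun ξ => F ((2 * Real.pi) • ξ)) 2 volume =
      (NNReal.sqrt (dilFactor n) : ℝ≥0∞) * eLpNorm F 2 volume := by
  have h : eLpNorm (fun ξ => F ((2 * Real.pi) • ξ)) 2 volume ^ 2 =
      ((NNReal.sqrt (dilFactor n) : ℝ≥0∞) * eLpNorm F 2 volume) ^ 2 := by
    rw [mul_pow, eLpNorm_two_sq, eLpNorm_two_sq,
      lintegral_dilation fun ξ => ‖F ξ‖ₑ ^ 2, ← ENNReal.coe_pow, NNReal.sq_sqrt]
  exact le_antisymm ((ENNReal.pow_le_pow_left_iff two_ne_zero).1 h.le)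
    ((ENNReal.pow_le_pow_left_iff two_ne_zero).1 h.ge)

/-- A change of variables. The constant may be enlarged freely so that two such inequalities can
share one. -/
theorem ConvLE.dilation {k₁ k₂ k : Rn n → ℝ} (h : ConvLE k₁ k₂ k) :
    ∃ C : ℝ, 0 < C ∧ ∀ C' : ℝ, C ≤ C' → ∀ ξ, ∫⁻ η,
      ENNReal.ofReal (1 / k₁ ((2 * Real.pi) • η) ^ 2) *
        ENNReal.ofReal (1 / k₂ ((2 * Real.pi) • (ξ - η)) ^ 2) ≤
      ENNReal.ofReal (C' ^ 2 / k ((2 * Real.pi) • ξ) ^ 2) := by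
  obtain ⟨C, hC, h⟩ := h
  refine ⟨NNReal.sqrt (dilFactor n) * C, mul_pos (by simpa using dilFactor_pos) hC,
    fun C' hC' ξ => ?_⟩
  have e := lintegral_dilation fun η => ENNReal.ofReal (1 / k₁ η ^ 2) *
    ENNReal.ofReal (1 / k₂ ((2 * Real.pi) • ξ - η) ^ 2)
  simp_rw [← smul_sub] at e
  rw [e]
  refine (mul_le_mul_right (h _) _).trans ?_
  rw [← ENNReal.ofReal_coe_nnreal, ← ENNReal.ofReal_mul (NNReal.coe_nonneg _)]
  refine ENNReal.ofReal_le_ofReal ?_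
  rw [← mul_div_assoc]
  gcongr
  calc (dilFactor n : ℝ) * C ^ 2 = (NNReal.sqrt (dilFactor n) * C) ^ 2 := by
        rw [mul_pow, ← NNReal.coe_pow, NNReal.sq_sqrt]
    _ ≤ _ := by gcongr

theorem bracket_sq (ξ : Rn n) : bracket ξ ^ 2 = 1 + ‖ξ‖ ^ 2 := Real.sq_sqrt (by positivity)

theorem one_le_bracket (ξ : Rn n) : 1 ≤ bracket ξ :=
  Real.one_le_sqrt.2 (by linarith [sq_nonneg ‖ξ‖])

theorem bracket_le (ξ : Rn n) : bracket ξ ≤ 1 + ‖ξ‖ :=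
  Real.sqrt_le_iff.2 ⟨by positivity, by nlinarith [norm_nonneg ξ]⟩

/-- In the normalization `e^{-2πi⟨x,ξ⟩}`, the weight `k` becomes `k(2π·)`. -/
theorem KWL.exists_wlWeight {k : Rn n → ℝ} (hk : k ∈ KWL n) :
    ∃ (b : Rn n → ℝ) (δ A C : ℝ) (N : ℕ),
      WLWeight (fun ξ => k ((2 * Real.pi) • ξ)) b δ A C N := by
  obtain ⟨⟨⟨hmeas, hpos, C₀, N, hC₀, hN, hgrow⟩, -⟩, δ, hδ0, hδ1, ⟨-, hconv⟩, hmem, hconv'⟩ := hk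
  obtain ⟨C₁, hC₁, h₁⟩ := hconv.dilation
  obtain ⟨C₂, hC₂, h₂⟩ := hconv'.dilation
  have hsm : Measurable fun ξ : Rn n => (2 * Real.pi) • ξ := measurableEmbedding_dilation.measurable
  have hbm : Measurable (bracket : Rn n → ℝ) :=
    (Real.continuous_sqrt.comp (by fun_prop)).measurable
  refine ⟨fun ξ => bracket ((2 * Real.pi) • ξ), δ, C₀ * (2 * Real.pi) ^ ⌈N⌉₊, max C₁ C₂, ⌈N⌉₊,
    { meas := hmeas.comp hsm
      pos := fun ξ => hpos _
      b_pos := fun ξ => one_pos.trans_le (one_le_bracket _)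
      b_meas := hbm.comp hsm
      b_sq_le := fun ξ η => ?_
      δ_pos := hδ0
      δ_lt_one := hδ1
      A_pos := by positivity
      C_pos := hC₁.trans_le (le_max_left _ _)
      growth := fun ξ η => ?_
      memLp := ?_
      conv_le := h₁ _ (le_max_left _ _)
      conv_le' := h₂ _ (le_max_right _ _) }⟩
  · rw [bracket_sq, bracket_sq, bracket_sq, smul_sub]
    set x := (2 * Real.pi) • ξ
    set y := (2 * Real.pi) • η
    have h : ‖x‖ ≤ ‖y‖ + ‖x - y‖ := by simpa using norm_add_le y (x - y)
    nlinarith [sq_nonneg (‖y‖ - ‖x - y‖), norm_nonneg x, norm_nonneg y, norm_nonneg (x - y)]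
  · rw [smul_add]
    refine (hgrow _ _).trans ?_
    have hkη := hpos ((2 * Real.pi) • η)
    rw [mul_assoc C₀ ((2 * Real.pi) ^ ⌈N⌉₊), ← mul_pow]
    refine mul_le_mul_of_nonneg_right (mul_le_mul_of_nonneg_left ?_ hC₀.le) hkη.le
    have hb : bracket ((2 * Real.pi) • ξ) ≤ 2 * Real.pi * (1 + ‖ξ‖) := by
      refine (bracket_le _).trans ?_
      rw [norm_smul, Real.norm_of_nonneg Real.two_pi_pos.le]
      nlinarith [Real.pi_gt_three]
    calc bracket ((2 * Real.pi) • ξ) ^ N ≤ bracket ((2 * Real.pi) • ξ) ^ (⌈N⌉₊ : ℝ) :=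
          Real.rpow_le_rpow_of_exponent_le (one_le_bracket _) (Nat.le_ceil N)
      _ = bracket ((2 * Real.pi) • ξ) ^ ⌈N⌉₊ := Real.rpow_natCast _ _
      _ ≤ _ := by
        have := one_le_bracket ((2 * Real.pi) • ξ)
        gcongr
  · have : MemLp (fun ξ => k ξ ^ (-δ)) 2
        ((volume : Measure (Rn n)).map fun ξ => (2 * Real.pi) • ξ) := by
      rw [map_dilation]
      exact hmem.smul_measure ENNReal.coe_ne_top
    exact (measurableEmbedding_dilation.memLp_map_measure_iff).1 this

end Scaling

/-! ### From distributions to functions and back -/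

section Bridge

variable {n : ℕ}

/-- The test function with underlying function `f`. -/
def mkTest (f : Rn n → ℂ) (hf : ContDiff ℝ ∞ f) (hc : HasCompactSupport f) : Test n where
  toFun := f
  contDiff' := hf
  hasCompactSupport' := hc
  tsupport_subset' := fun _ _ => trivial

theorem cutoff_apply (χ : Test n) (u : Distr n) (φ : 𝓢(Rn n, ℂ)) (t : Test n)
    (ht : ∀ x, t x = χ x * φ x) : cutoff χ u φ = u t := by
  have : t = TestFunction.ofSupportedInCLM ℂ (Ω := (⊤ : Opens (Rn n))) (fun _ _ => trivial)
      (mulLM χ φ) := by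
    ext x
    exact ht x
  rw [this]
  rfl

theorem ofFun_apply {f : Rn n → ℂ} (hf : Continuous f) (t : Test n) :
    ofFun f t = ∫ x, t x * f x := by
  rw [ofFun, TestFunction.integralAgainstBilinCLM_eq_integral
    (hf.locallyIntegrable.locallyIntegrableOn _)]
  rfl

/-- A tempered distribution in `ℬ_k` is a function in the algebra of `k(2π·)`. -/
theorem exists_inA_of_isFourierTransform {k : Rn n → ℝ} {K : ℝ≥0}
    (hw : AlgWeight (fun ξ => k ((2 * Real.pi) • ξ)) K) {T : 𝓢'(Rn n, ℂ)} {g : Rn n → ℂ}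
    (hg : IsFourierTransform T g) {M : ℝ≥0}
    (hM : eLpNorm (fun ξ => (k ξ : ℂ) * g ξ) 2 volume ≤ M) :
    ∃ γ, InA (fun ξ => k ((2 * Real.pi) • ξ)) γ (NNReal.sqrt (dilFactor n) * M) ∧
      ∀ φ : 𝓢(Rn n, ℂ), T φ = ∫ x, φ x * γ x := by
  have hspec : HasSpec (fun ξ => k ((2 * Real.pi) • ξ)) (𝓕⁻ fun ξ => g ((2 * Real.pi) • ξ))
      (fun ξ => g ((2 * Real.pi) • ξ)) (NNReal.sqrt (dilFactor n) * M) := by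
    refine ⟨hg.1.aestronglyMeasurable.comp_quasiMeasurePreserving
      quasiMeasurePreserving_dilation, ?_, rfl⟩
    rw [eLpNorm_dilation fun ξ => (k ξ : ℂ) * g ξ, ENNReal.coe_mul]
    gcongr
  refine ⟨_, ⟨_, hspec⟩, fun φ => ?_⟩
  have h := hg.2 (𝓕⁻ φ)
  rw [TemperedDistribution.fourier_apply, FourierTransform.fourier_fourierInv_eq] at h
  rw [h, SchwartzMap.fourierInv_coe, integral_fourierInv_mul_eq φ.integrable (hw.integrable hspec)]

/-- A function in the algebra of `k(2π·)` defines an element of `ℬ_k`. -/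
theorem mem_Bk_of_inA {k : Rn n → ℝ} {K : ℝ≥0}
    (hw : AlgWeight (fun ξ => k ((2 * Real.pi) • ξ)) K) {T : 𝓢'(Rn n, ℂ)} {γ : Rn n → ℂ}
    {M : ℝ≥0} (hγ : InA (fun ξ => k ((2 * Real.pi) • ξ)) γ M)
    (hT : ∀ φ : 𝓢(Rn n, ℂ), T φ = ∫ x, φ x * γ x) :
    T ∈ Bk k ∧ normBk k T ≤ ((NNReal.sqrt (dilFactor n))⁻¹ * M : ℝ≥0) := by
  obtain ⟨G, hG⟩ := hγ
  have hpi : (2 * Real.pi) ≠ 0 := Real.two_pi_pos.ne'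
  set g : Rn n → ℂ := fun ξ => G ((2 * Real.pi)⁻¹ • ξ) with hg
  have hgG : ∀ ξ, g ((2 * Real.pi) • ξ) = G ξ := fun ξ => by
    simp only [hg, smul_smul, inv_mul_cancel₀ hpi, one_smul]
  have hInt : Integrable g volume := (hw.integrable hG).comp_smul (inv_ne_zero hpi)
  have hFT : IsFourierTransform T g := by
    refine ⟨hInt.locallyIntegrable, fun φ => ?_⟩
    simp_rw [hgG]
    rw [TemperedDistribution.fourier_apply, hT, hG.eq,
      ← integral_fourierInv_mul_eq (𝓕 φ).integrable (hw.integrable hG),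
      ← SchwartzMap.fourierInv_coe, FourierTransform.fourierInv_fourier_eq]
  have hs : NNReal.sqrt (dilFactor n) ≠ 0 := by simpa using dilFactor_pos.ne'
  have hnorm : eLpNorm (fun ξ => (k ξ : ℂ) * g ξ) 2 volume ≤
      ((NNReal.sqrt (dilFactor n))⁻¹ * M : ℝ≥0) := by
    have h := eLpNorm_dilation fun ξ => (k ξ : ℂ) * g ξ
    simp_rw [hgG] at h
    have h2 := hG.norm_le
    rw [h] at h2
    rw [ENNReal.coe_mul, ENNReal.coe_inv hs]
    rwa [mul_comm, ← div_eq_mul_inv, ENNReal.le_div_iff_mul_le (by simp [hs]) (by simp), mul_comm]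
  have hkm : Measurable k := by
    have : k = (fun ξ => k ((2 * Real.pi) • ξ)) ∘ fun ξ => (2 * Real.pi)⁻¹ • ξ := by
      ext ξ
      rw [Function.comp_apply, smul_smul, mul_inv_cancel₀ hpi, one_smul]
    rw [this]
    exact hw.meas.comp (measurable_const_smul _)
  refine ⟨⟨g, hFT, ?_, hnorm.trans_lt ENNReal.coe_lt_top⟩, (iInf₂_le g hFT).trans hnorm⟩
  exact ((Complex.measurable_ofReal.comp hkm).aestronglyMeasurable).mul hInt.aestronglyMeasurable

/-- Off the support of `φ` the quotient vanishes in a neighbourhood, whatever `S` is, because `0 / 0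
= 0`. -/
theorem contDiff_div_of_ne_zero {φ S : Rn n → ℂ} (hφ : ContDiff ℝ ∞ φ) (hS : ContDiff ℝ ∞ S)
    (h : ∀ x ∈ tsupport φ, S x ≠ 0) : ContDiff ℝ ∞ fun x => φ x / S x := by
  rw [contDiff_iff_contDiffAt]
  intro x
  by_cases hx : x ∈ tsupport φ
  · simp_rw [div_eq_mul_inv]
    exact hφ.contDiffAt.mul (hS.contDiffAt.inv (h x hx))
  · have : (fun x => φ x / S x) =ᶠ[nhds x] fun _ => 0 := by
      filter_upwards [notMem_tsupport_iff_eventuallyEq.1 hx] with y hy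
      simp [hy]
    exact contDiffAt_const.congr_of_eventuallyEq this

theorem eq_of_integral_test_eq {f g : Rn n → ℂ} (hf : Continuous f) (hg : Continuous g)
    (h : ∀ φ : Rn n → ℂ, ContDiff ℝ ∞ φ → HasCompactSupport φ →
      ∫ x, φ x * f x = ∫ x, φ x * g x) : f = g := by
  have hae : ∀ᵐ x ∂(volume : Measure (Rn n)), f x = g x := by
    refine ae_eq_of_integral_contDiff_smul_eq hf.locallyIntegrable hg.locallyIntegrable
      fun φ hφ hφc => ?_
    simpa using h (fun x => (φ x : ℂ)) (Complex.ofRealCLM.contDiff.comp hφ)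
      (hφc.comp_left (g := fun t : ℝ => (t : ℂ)) rfl)
  exact (hf.ae_eq_iff_eq volume hg).1 hae

theorem ofFun_injective {f g : Rn n → ℂ} (hf : Continuous f) (hg : Continuous g)
    (h : ofFun f = ofFun g) : f = g :=
  eq_of_integral_test_eq hf hg fun φ hφ hφc => by
    have := congrArg (fun u : Distr n => u (mkTest φ hφ hφc)) h
    simpa only [ofFun_apply hf, ofFun_apply hg] using! this

/-- The elements of `ℬ_k^∞` are functions that belong to the algebra of `k(2π·)` uniformly
locally. -/
theorem BkInfty.exists_eq_ofFun {k : Rn n → ℝ} {b : Rn n → ℝ} {δ A C : ℝ} {N : ℕ}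
    (hw : WLWeight (fun ξ => k ((2 * Real.pi) • ξ)) b δ A C N) {u : Distr n}
    (hu : u ∈ BkInfty k) :
    ∃ f : Rn n → ℂ, Continuous f ∧ UnifLocA (fun ξ => k ((2 * Real.pi) • ξ)) f ∧ u = ofFun f := by
  obtain ⟨K, hK⟩ := hw.exists_algWeight
  obtain ⟨χ, hχ, -, hsup⟩ := hu
  obtain ⟨M, hM⟩ : ∃ M : ℝ≥0, ⨆ y, normBk k (cutoff (translate y χ) u) < M :=
    ENNReal.lt_iff_exists_nnreal_btwn.1 hsup |>.imp fun M h => h.1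
  have hγ : ∀ y, ∃ γ, InA (fun ξ => k ((2 * Real.pi) • ξ)) γ (NNReal.sqrt (dilFactor n) * M) ∧
      ∀ φ : 𝓢(Rn n, ℂ), cutoff (translate y χ) u φ = ∫ x, φ x * γ x := by
    intro y
    have h1 : normBk k (cutoff (translate y χ) u) < M := (le_iSup _ y).trans_lt hM
    obtain ⟨g, h2⟩ := iInf_lt_iff.1 h1
    obtain ⟨hg, h3⟩ := iInf_lt_iff.1 h2
    exact exists_inA_of_isFourierTransform hK hg h3.le
  choose γ hγA hγ using hγ
  have hγc : ∀ y, Continuous (γ y) := fun y => (hγA y).continuous hK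
  have hcd : ∀ y : Rn n, ContDiff ℝ ∞ fun x => χ (x - y) := fun y => (translate y χ).contDiff
  have hχc : Continuous (χ : Rn n → ℂ) := χ.continuous
  obtain ⟨x₀, hx₀⟩ : ∃ x₀, χ x₀ ≠ 0 := by
    by_contra! hcon
    exact hχ (by ext x; exact hcon x)
  have hu_eq : ∀ (y : Rn n) (φ : Rn n → ℂ) (hφ : ContDiff ℝ ∞ φ) (hφc : HasCompactSupport φ)
      (t : Test n), (∀ x, t x = χ (x - y) * φ x) → u t = ∫ x, φ x * γ y x := by
    intro y φ hφ hφc t ht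
    rw [← cutoff_apply (translate y χ) u (hφc.toSchwartzMap hφ) t ht, hγ]
    rfl
  -- Tested against `φ`, both sides give `u` applied to `χ(· - y) χ(· - y') φ`.
  have hcons : ∀ y y' x, χ (x - y') * γ y x = χ (x - y) * γ y' x := by
    intro y y'
    refine congrFun (eq_of_integral_test_eq
      ((hχc.comp (continuous_id.sub continuous_const)).mul (hγc y))
      ((hχc.comp (continuous_id.sub continuous_const)).mul (hγc y')) fun φ hφ hφc => ?_)
    have h1 := hu_eq y (fun x => φ x * χ (x - y')) (hφ.mul (hcd y')) hφc.mul_right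
      (mkTest (fun x => χ (x - y) * (φ x * χ (x - y'))) ((hcd y).mul (hφ.mul (hcd y')))
        hφc.mul_right.mul_left) fun x => rfl
    have h2 := hu_eq y' (fun x => φ x * χ (x - y)) (hφ.mul (hcd y)) hφc.mul_right
      (mkTest (fun x => χ (x - y) * (φ x * χ (x - y'))) ((hcd y).mul (hφ.mul (hcd y')))
        hφc.mul_right.mul_left) fun x => by
          change χ (x - y) * (φ x * χ (x - y')) = χ (x - y') * (φ x * χ (x - y))
          ring
    rw [h1] at h2
    simpa only [mul_assoc] using h2
  -- At each `x` use the translate `y = x - x₀`, for which `χ(x - y) = χ(x₀) ≠ 0`; `hcons` makes the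
  -- choice immaterial.
  set f : Rn n → ℂ := fun x => γ (x - x₀) x / χ x₀ with hf
  have hfγ : ∀ y x, χ (x - y) * f x = γ y x := by
    intro y x
    have := hcons (x - x₀) y x
    rw [sub_sub_cancel] at this
    simp only [hf]
    rw [← mul_div_assoc, this, mul_div_cancel_left₀ _ hx₀]
  have hgrow : ∀ ξ : Rn n, k ((2 * Real.pi) • ξ) ≤ A * k ((2 * Real.pi) • (0 : Rn n)) *
      (1 + ‖ξ‖) ^ N := fun ξ => by
    have := hw.growth ξ 0
    rw [add_zero] at this
    linarith
  have hloc : UnifLocA (fun ξ => k ((2 * Real.pi) • ξ)) f := by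
    have hopen : IsOpen {x | χ x ≠ 0} := isOpen_ne_fun hχc continuous_const
    obtain ⟨r, hr, hball⟩ := Metric.isOpen_iff.1 hopen x₀ hx₀
    refine ⟨r, hr, fun θ h1 h2 h3 => ?_⟩
    have hne : ∀ x ∈ tsupport θ, χ (x + x₀) ≠ 0 := fun x hx => hball (by
      have := h3 hx
      simpa using this)
    have hsh : ContDiff ℝ ∞ fun x => χ (x + x₀) :=
      (χ.contDiff).comp (contDiff_id.add contDiff_const)
    have hq := contDiff_div_of_ne_zero h1 hsh hne
    have hqc : HasCompactSupport fun x => θ x / χ (x + x₀) := by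
      simp_rw [div_eq_mul_inv]
      exact h2.mul_right
    obtain ⟨Mq, hMq⟩ := exists_inA_of_contDiff hw.meas (fun ξ => (hw.pos ξ).le) hgrow hq hqc
    -- Near `z`, `θ(· - z) f` is a translate of the fixed smooth function `θ / χ(· + x₀)` times `γ
    -- (z - x₀)`, so the bound does not depend on `z`.
    refine ⟨K * Mq * (NNReal.sqrt (dilFactor n) * M), fun z => ?_⟩
    have h4 := (hMq.comp_sub z).mul hK (hγA (z - x₀))
    have e : (fun x => θ (x - z) * f x) =
        (fun x => θ (x - z) / χ (x - z + x₀)) * γ (z - x₀) := by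
      ext x
      rw [Pi.mul_apply, ← hfγ (z - x₀) x, show x - (z - x₀) = x - z + x₀ by abel]
      by_cases hx : θ (x - z) = 0
      · simp [hx]
      · have := hne (x - z) (subset_tsupport _ hx)
        field_simp
    rw [e]
    exact h4
  have hfc : Continuous f := by
    rw [Metric.continuous_iff]
    intro z ε hε
    obtain ⟨s, hs, h⟩ := hloc.uniformContinuous hK (half_pos hε)
    refine ⟨s, hs, fun x hx => ?_⟩
    rw [dist_eq_norm] at hx ⊢
    exact (h x z hx).trans_lt (half_lt_self hε)
  refine ⟨f, hfc, hloc, ?_⟩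
  ext t
  rw [ofFun_apply hfc]
  obtain ⟨F, -, hF⟩ := t.hasCompactSupport.isCompact.elim_nhds_subcover
    (fun z => {x | χ (x - (z - x₀)) ≠ 0}) fun z _ =>
      (isOpen_ne_fun (hχc.comp (continuous_id.sub continuous_const)) continuous_const).mem_nhds
        (by simpa using hx₀)
  -- A partition of unity on the support of `t`: finitely many translates of `|χ|²` have a positive
  -- sum there, and dividing by it writes `t` as a sum of products `χ(· - y) φ`.
  set S : Rn n → ℂ := fun x => ∑ z ∈ F, ((Complex.normSq (χ (x - (z - x₀))) : ℝ) : ℂ) with hS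
  have hSc : ContDiff ℝ ∞ S := by
    refine ContDiff.sum fun z _ => ?_
    have : (fun x => ((Complex.normSq (χ (x - (z - x₀))) : ℝ) : ℂ)) =
        fun x => (starRingEnd ℂ) (χ (x - (z - x₀))) * χ (x - (z - x₀)) := by
      ext x
      rw [Complex.normSq_eq_conj_mul_self]
    rw [this]
    exact (Complex.conjCLE.contDiff.comp (hcd _)).mul (hcd _)
  have hS0 : ∀ x ∈ tsupport t, S x ≠ 0 := by
    intro x hx
    obtain ⟨z, hz, hxz⟩ := Set.mem_iUnion₂.1 (hF hx)
    simp only [hS]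
    rw [← Complex.ofReal_sum]
    refine Complex.ofReal_ne_zero.2 (ne_of_gt ?_)
    exact Finset.sum_pos' (fun _ _ => Complex.normSq_nonneg _)
      ⟨z, hz, Complex.normSq_pos.2 hxz⟩
  have hts : ContDiff ℝ ∞ fun x => t x / S x := contDiff_div_of_ne_zero t.contDiff hSc hS0
  have htsc : HasCompactSupport fun x => t x / S x := by
    simp_rw [div_eq_mul_inv]
    exact t.hasCompactSupport.mul_right
  set φ : Rn n → Rn n → ℂ := fun z x => (starRingEnd ℂ) (χ (x - (z - x₀))) * (t x / S x) with hφ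
  have hφs : ∀ z, ContDiff ℝ ∞ (φ z) := fun z => (Complex.conjCLE.contDiff.comp (hcd _)).mul hts
  have hφc : ∀ z, HasCompactSupport (φ z) := fun z => htsc.mul_left
  let s : Rn n → Test n := fun z =>
    mkTest (fun x => χ (x - (z - x₀)) * φ z x) ((hcd _).mul (hφs z)) (hφc z).mul_left
  have hsum : ∀ x, ∑ z ∈ F, χ (x - (z - x₀)) * φ z x = t x := by
    intro x
    have e : ∀ z, χ (x - (z - x₀)) * φ z x =
        ((Complex.normSq (χ (x - (z - x₀))) : ℝ) : ℂ) * (t x / S x) := fun z => by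
      rw [Complex.normSq_eq_conj_mul_self]
      simp only [hφ]
      ring
    simp_rw [e, ← Finset.sum_mul]
    by_cases hx : x ∈ tsupport t
    · exact mul_div_cancel₀ _ (hS0 x hx)
    · simp [image_eq_zero_of_notMem_tsupport hx]
  have ht : t = ∑ z ∈ F, s z := by
    ext x
    rw [FunLike.coe_sum, Finset.sum_apply]
    exact (hsum x).symm
  conv_lhs => rw [ht, map_sum]
  have hInt : ∀ z ∈ F, Integrable (fun x => φ z x * γ (z - x₀) x) volume := fun z _ =>
    ((hφs z).continuous.mul (hγc _)).integrable_of_hasCompactSupport (hφc z).mul_right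
  rw [Finset.sum_congr rfl fun z _ => hu_eq (z - x₀) (φ z) (hφs z) (hφc z) (s z) fun x => rfl,
    ← integral_finsetSum _ hInt]
  refine integral_congr_ae (ae_of_all _ fun x => ?_)
  dsimp only
  rw [← hsum x, Finset.sum_mul]
  refine Finset.sum_congr rfl fun z _ => ?_
  rw [← hfγ (z - x₀) x]
  ring

end Bridge

end KatoSobolev

/-! ### The theorem -/

theorem mainTheorem1 {n d : ℕ} (k : KatoSobolev.Rn n → ℝ) (hk : k ∈ KatoSobolev.KWL n)
    (Ω : Set (Fin d → ℂ)) (hΩ : IsOpen Ω) (Φ : (Fin d → ℂ) → ℂ) (hΦ : DifferentiableOn ℂ Φ Ω)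
    (u : Fin d → KatoSobolev.Distr n) (hu : ∀ j, u j ∈ KatoSobolev.BkInfty k) :
    -- `u` is given by a bounded continuous function
    (∃ f : KatoSobolev.Rn n → (Fin d → ℂ), Continuous f ∧ Bornology.IsBounded (Set.range f) ∧
      ∀ j, u j = KatoSobolev.ofFun (fun x => f x j)) ∧
    -- and if the closure of its range lies in `Ω`, then `Φ ∘ u` belongs to the space
    (∀ f : KatoSobolev.Rn n → (Fin d → ℂ), Continuous f →
      (∀ j, u j = KatoSobolev.ofFun (fun x => f x j)) →
      closure (Set.range f) ⊆ Ω →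
      KatoSobolev.ofFun (fun x => Φ (f x)) ∈ KatoSobolev.BkInfty k) := by
  obtain ⟨b, δ, A, C, N, hw⟩ := KatoSobolev.KWL.exists_wlWeight hk
  obtain ⟨K, hK⟩ := hw.exists_algWeight
  choose f₀ hf₀c hf₀A hf₀u using fun j => KatoSobolev.BkInfty.exists_eq_ofFun hw (hu j)
  refine ⟨⟨fun x j => f₀ j x, continuous_pi hf₀c, ?_, hf₀u⟩, fun f hf hfu hfΩ => ?_⟩
  · exact KatoSobolev.UnifLocA.isBounded_range hK hf₀A
  · have hfA : ∀ j, KatoSobolev.UnifLocA (fun ξ => k ((2 * Real.pi) • ξ)) fun x => f x j := by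
      intro j
      -- A continuous function is determined by its distribution, so the given representative
      -- inherits the local bounds of the constructed one.
      have h : f₀ j = fun x => f x j := KatoSobolev.ofFun_injective (hf₀c j)
        ((continuous_apply j).comp hf) ((hf₀u j).symm.trans (hfu j))
      exact h ▸ hf₀A j
    obtain ⟨ψ, ψ1, ψ2, ψ3, M, hM⟩ := hw.wienerLevy hfA hΩ hΦ hfΩ
    have hΦf : Continuous fun x => Φ (f x) :=
      hΦ.continuousOn.comp_continuous hf fun x => hfΩ (subset_closure (Set.mem_range_self x))
    have key : ∀ y, KatoSobolev.cutoff (KatoSobolev.translate y (KatoSobolev.mkTest ψ ψ1 ψ2))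
        (KatoSobolev.ofFun fun x => Φ (f x)) ∈ KatoSobolev.Bk k ∧
        KatoSobolev.normBk k (KatoSobolev.cutoff
          (KatoSobolev.translate y (KatoSobolev.mkTest ψ ψ1 ψ2))
          (KatoSobolev.ofFun fun x => Φ (f x))) ≤
          ((NNReal.sqrt (KatoSobolev.dilFactor n))⁻¹ * M : NNReal) := by
      intro y
      refine KatoSobolev.mem_Bk_of_inA hK (hM y) fun φ => ?_
      have hs : ContDiff ℝ ∞ fun x => ψ (x - y) := ψ1.comp (contDiff_id.sub contDiff_const)
      have hsc : HasCompactSupport fun x => ψ (x - y) :=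
        ψ2.comp_homeomorph (Homeomorph.subRight y)
      rw [KatoSobolev.cutoff_apply _ _ φ (KatoSobolev.mkTest (fun x => ψ (x - y) * φ x)
        (hs.mul (φ.smooth ⊤)) hsc.mul_right) fun x => rfl, KatoSobolev.ofFun_apply hΦf]
      refine integral_congr_ae (ae_of_all _ fun x => ?_)
      change ψ (x - y) * φ x * Φ (f x) = φ x * (ψ (x - y) * Φ (f x))
      ring
    refine ⟨KatoSobolev.mkTest ψ ψ1 ψ2, fun h => ψ3 ?_, fun y => (key y).1,
      (iSup_le fun y => (key y).2).trans_lt ENNReal.coe_lt_top⟩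
    exact congrArg (fun t : KatoSobolev.Test n => t 0) h
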